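/- Let $A$ be a multiplicative abelian group and $R$ a commutative ring with unity. **Fibered sets and bisets.** For a group $G$, an $A$-fibered $G$-set is a $(G\times A)$-set $X$ with finitely many $A$-orbits on which $A$ acts freely; morphisms are the $(G\times A)$-equivariant maps. For $x\in X$ let $G_x\le G$ be the stabilizer of the $A$-orbit of $x$. An $A$-fibered $(G,H)$-biset $U$ is an $A$-fibered $(G\times H)$-set, where one writes $guh=(g,h^{-1})u$. The stabilizing pair of $u\in U$ is $((G\times H)_u,\phi_u)$, where $(G\times H)_u$ is the stabilizer of the $A$-orbit of $u$ and $\phi_u:(G\times H)_u\to A$ is the homomorphism with $(g,h)u=\phi_u(g,h)u$. For an $A$-fibered $(G,H)$-biset $U$ and an $A$-fibered $(H,K)$-biset $V$ (resp. $A$-fibered $H$-set $V$), $U\otimes_{AH}V$ is the $A$-fibered $(G,K)$-biset (resp. $G$-set) of those $(H\times A)$-orbits $u\otimes v$ of $U\times V$, under $(h,a)(u,v)=(u(ha)^{-1},hav)$, that are $A$-free for the induced action $a(u\otimes v)=au\otimes v$. **Pairs.** Let $\mathcal M(G)$ be the set of pairs $(D,\phi)$ with $D\le G$ and $\phi\in\mathrm{Hom}(D,A)$;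 $G$ acts on it by conjugation. For $D\le G\times H$ and $K\le H$ let $p_1(D)\le G$ be the first projection and $D*K=\{g : (g,h)\in D\text{ for some }h\in K\}$. If $(D,\phi)\in\mathcal M(G\times H)$ and $(E,\psi)\in\mathcal M(H\times K)$ satisfy $\phi(1,h)^{-1}=\psi(h,1)$ whenever $(1,h)\in D$ and $(h,1)\in E$ (call them composable), put $(D,\phi)*(E,\psi)=(D*E,\phi*\psi)$, where $D*E=\{(g,k): (g,h)\in D,\ (h,k)\in E\text{ for some }h\}$ and $(\phi*\psi)(g,k)=\phi(g,h)\psi(h,k)$. Put $\Delta(K)=\{(k,k):k\in K\}$. Write $\left[\frac{G\times H}{D,\phi}\right]$ for the class of the biset $(G\times H\times A)/\{(g,h,\phi(g,h)^{-1}):(g,h)\in D\}$. **The category $\mathcal D$.** Let $\mathcal G$ be a class of finite groups and $\mathcal S(G,H)\subseteq\mathcal M(G\times H)$, for $G,H\in\mathcal G$, subsets such that, for all $G,H,K\in\mathcal G$: 1. $(\Delta(G),1)\in\mathcal S(G,G)$; 2. $\mathcal S(G,H)$ is closed under $(G\times H)$-conjugation; 3. if $(D,\phi)\in\mathcal S(G,H)$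 and $(E,\psi)\in\mathcal S(H,K)$ are composable, then $(D,\phi)*(E,\psi)\in\mathcal S(G,K)$; 4. if $(D,\phi)\in\mathcal S(G,H)$ and $L\le H$ with $L\in\mathcal G$, then $D*L\in\mathcal G$ and $(D,\phi)*(\Delta(L),1)\in\mathcal S(D*L,L)$. Let $B^A(G,H)$ be the Grothendieck group of $A$-fibered $(G,H)$-bisets under disjoint union. The category $\mathcal D$ has the objects $\mathcal G$; the morphisms $H\to G$ are the elements of the $R$-span of the classes $\left[\frac{G\times H}{D,\phi}\right]$, $(D,\phi)\in\mathcal S(G,H)$, in $R\otimes_{\mathbb Z}B^A(G,H)$; composition is induced by the tensor product of bisets; and the identity of $G$ is $\left[\frac{G\times G}{\Delta(G),1}\right]$. Let $F:\mathcal D\to R\text{-}\mathrm{Mod}$ be an $R$-linear functor. Let $\mathcal S_+(G,H)$ be the set of $(D,\phi)\in\mathcal M(G\times H)$ with $p_1(D)\in\mathcal G$ and $(D,\phi)\in\mathcal S(p_1(D),H)$. **The categories $\Gamma_F(G)$.** For $G\in\mathcal G$, an object of $\Gamma_F(G)$ is a pair $(X,s)$, where $X$ is an $A$-fibered $G$-set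 with $G_x\in\mathcal G$ for all $x\in X$, and $s$ assigns to each $x\in X$ an element $s(x)\in F(G_x)$ such that $F(\mathrm{Iso}(C_g))(s(g^{-1}ax))=s(x)$ for all $g\in G$, $a\in A$, $x\in X$; here $C_g:G_{g^{-1}ax}\to G_x$ is conjugation by $g$ and $\mathrm{Iso}(C_g)=\left[\frac{G_x\times G_{g^{-1}ax}}{\{(gkg^{-1},k)\},\,1}\right]$. A morphism $(X,s)\to(Y,t)$ is a morphism $\alpha:X\to Y$ of $A$-fibered $G$-sets with $G_{\alpha(x)}=G_x$ and $t(\alpha(x))=s(x)$ for all $x\in X$. **The functors $\Gamma_F(U)$.** Let $G,H\in\mathcal G$ and let $U$ be an $A$-fibered $(G,H)$-biset with $((G\times H)_u,\phi_u)\in\mathcal S_+(G,H)$ for all $u\in U$. The functor $\Gamma_F(U):\Gamma_F(H)\to\Gamma_F(G)$ sends $(X,s)$ to $(U\otimes_{AH}X,U(s))$, where $$U(s)(u\otimes x)=F\left(\left[\frac{G_{u\otimes x}\times H_x}{((G\times H)_u,\phi_u)*(\Delta(H_x),1)}\right]\right)(s(x)),$$ and sends $\alpha$ to $U\otimes_{AH}\alpha$.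 **Proposition.** Let $G,H,K\in\mathcal G$. Let $U$ be an $A$-fibered $(G,H)$-biset with $((G\times H)_u,\phi_u)\in\mathcal S_+(G,H)$ for all $u\in U$, and let $V$ be an $A$-fibered $(H,K)$-biset with $((H\times K)_v,\phi_v)\in\mathcal S_+(H,K)$ for all $v\in V$. Then $((G\times K)_z,\phi_z)\in\mathcal S_+(G,K)$ for all $z\in U\otimes_{AH}V$, so that $\Gamma_F(U\otimes_{AH}V)$ is defined, and the functors $\Gamma_F(U\otimes_{AH}V)$ and $\Gamma_F(U)\circ\Gamma_F(V)$ from $\Gamma_F(K)$ to $\Gamma_F(G)$ are naturally isomorphic. -/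

import Mathlib

open CategoryTheory
open scoped TensorProduct

universe u v w

namespace Fibered

/-! ### Fibered sets -/

/-- An `A`-fibered `G`-set: a `(G × A)`-set (given as commuting actions of `G` and of `A`) which is
free as an `A`-set and has only finitely many `A`-orbits. -/
structure FibSet (A G : Type u) [CommGroup A] [Group G] where
  carrier : Type u
  [actG : MulAction G carrier]
  [actA : MulAction A carrier]
  [comm : SMulCommClass G A carrier]
  free : ∀ (a b : A) (x : carrier), a • x = b • x → a = b
  finite : Finite (MulAction.orbitRel.Quotient A carrier)

attribute [instance] FibSet.actG FibSet.actA FibSet.comm FibSet.finite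

instance {A G : Type u} [CommGroup A] [Group G] (X : FibSet A G) :
    SMulCommClass A G X.carrier := SMulCommClass.symm _ _ _

instance {A G : Type u} [CommGroup A] [Group G] : CoeSort (FibSet A G) (Type u) :=
  ⟨FibSet.carrier⟩

section Basic

variable {A G G' : Type u} [CommGroup A] [Group G] [Group G']

/-- Morphisms of `A`-fibered `G`-sets: the `(G × A)`-equivariant maps. -/
@[ext] structure FibSet.Hom (X Y : FibSet A G) where
  toFun : X → Y
  map_smul : ∀ (g : G) (x : X), toFun (g • x) = g • toFun x
  map_smulA : ∀ (a : A) (x : X), toFun (a • x) = a • toFun x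

instance (X Y : FibSet A G) : CoeFun (FibSet.Hom X Y) (fun _ => X → Y) := ⟨FibSet.Hom.toFun⟩

def FibSet.Hom.id (X : FibSet A G) : FibSet.Hom X X := ⟨fun x => x, fun _ _ => rfl, fun _ _ => rfl⟩

def FibSet.Hom.comp {X Y Z : FibSet A G} (f : FibSet.Hom X Y) (g : FibSet.Hom Y Z) :
    FibSet.Hom X Z :=
  ⟨fun x => g (f x), fun m x => by rw [f.map_smul, g.map_smul],
    fun a x => by rw [f.map_smulA, g.map_smulA]⟩

/-- Two `A`-fibered `G`-sets are isomorphic. -/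
def FibSet.Isom (X Y : FibSet A G) : Prop := ∃ f : FibSet.Hom X Y, Function.Bijective f

theorem FibSet.Isom.refl (X : FibSet A G) : FibSet.Isom X X := ⟨.id X, Function.bijective_id⟩

theorem FibSet.Isom.symm {X Y : FibSet A G} (h : FibSet.Isom X Y) : FibSet.Isom Y X := by
  obtain ⟨f, hf⟩ := h
  let e := Equiv.ofBijective f hf
  refine ⟨⟨e.symm, fun g y => ?_, fun a y => ?_⟩, e.symm.bijective⟩
  · apply hf.1
    rw [f.map_smul]
    change e (e.symm (g • y)) = g • e (e.symm y)
    simp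
  · apply hf.1
    rw [f.map_smulA]
    change e (e.symm (a • y)) = a • e (e.symm y)
    simp

theorem FibSet.Isom.trans {X Y Z : FibSet A G} (h : FibSet.Isom X Y) (h' : FibSet.Isom Y Z) :
    FibSet.Isom X Z := by
  obtain ⟨f, hf⟩ := h
  obtain ⟨g, hg⟩ := h'
  exact ⟨f.comp g, hg.comp hf⟩

/-- A criterion for isomorphism: both sets are parametrized by the same `T`. -/
theorem FibSet.Isom.of_param {X Y : FibSet A G} {T : Type*} (p : T → X) (q : T → Y)
    (hp : Function.Surjective p) (hq : Function.Surjective q)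
    (hpq : ∀ t t', p t = p t' ↔ q t = q t')
    (hG : ∀ (g : G) t, ∃ t', p t' = g • p t ∧ q t' = g • q t)
    (hA : ∀ (a : A) t, ∃ t', p t' = a • p t ∧ q t' = a • q t) : FibSet.Isom X Y := by
  choose r hr using hp
  have key : ∀ t, q (r (p t)) = q t := fun t => (hpq _ _).1 (hr _)
  refine ⟨⟨fun x => q (r x), fun g x => ?_, fun a x => ?_⟩, fun x y hxy => ?_, fun y => ?_⟩
  · obtain ⟨t', h1, h2⟩ := hG g (r x)
    rw [hr] at h1
    rw [← h1, key, h2]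
  · obtain ⟨t', h1, h2⟩ := hA a (r x)
    rw [hr] at h1
    rw [← h1, key, h2]
  · have := (hpq _ _).2 hxy
    rwa [hr, hr] at this
  · obtain ⟨t, rfl⟩ := hq y
    exact ⟨p t, key t⟩

/-- The same set, with `G'` acting through a homomorphism `G' → G`. -/
def FibSet.comap (f : G' →* G) (X : FibSet A G) : FibSet A G' :=
  letI actG : MulAction G' X.carrier := MulAction.compHom X f
  letI actA : MulAction A X.carrier := X.actA
  { carrier := X
    actG := actG
    actA := actA
    comm := ⟨fun g a x => X.comm.smul_comm (f g) a x⟩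
    free := X.free
    finite := X.finite }

theorem FibSet.comap_smul (f : G' →* G) (X : FibSet A G) (g : G') (x : X.comap f) :
    g • x = (show X.comap f from f g • (show X from x)) := rfl

/-- Disjoint union of `A`-fibered `G`-sets. -/
def FibSet.sum (X Y : FibSet A G) : FibSet A G :=
  { carrier := X ⊕ Y
    actG :=
      { smul := fun g => Sum.map (g • ·) (g • ·)
        one_smul := by rintro (x | x) <;> simp [HSMul.hSMul, SMul.smul] <;> exact one_smul _ _
        mul_smul := by
          rintro g h (x | x)
          · exact congrArg Sum.inl (mul_smul g h x)
          · exact congrArg Sum.inr (mul_smul g h x) }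
    actA :=
      { smul := fun g => Sum.map (g • ·) (g • ·)
        one_smul := by rintro (x | x) <;> simp [HSMul.hSMul, SMul.smul] <;> exact one_smul _ _
        mul_smul := by
          rintro g h (x | x)
          · exact congrArg Sum.inl (mul_smul g h x)
          · exact congrArg Sum.inr (mul_smul g h x) }
    comm := ⟨by
      rintro g a (x | x)
      · exact congrArg Sum.inl (smul_comm g a x)
      · exact congrArg Sum.inr (smul_comm g a x)⟩
    free := by
      rintro a b (x | x) h
      · exact X.free a b x (Sum.inl_injective h)
      · exact Y.free a b x (Sum.inr_injective h)
    finite := by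
      refine Finite.of_surjective
        (α := MulAction.orbitRel.Quotient A X ⊕ MulAction.orbitRel.Quotient A Y)
        (Sum.elim (Quotient.lift (fun x => Quotient.mk _ (Sum.inl x)) ?_)
          (Quotient.lift (fun x => Quotient.mk _ (Sum.inr x)) ?_)) ?_
      · rintro x y ⟨a, rfl⟩
        exact Quotient.sound ⟨a, rfl⟩
      · rintro x y ⟨a, rfl⟩
        exact Quotient.sound ⟨a, rfl⟩
      · rintro ⟨x | x⟩
        · exact ⟨Sum.inl (Quotient.mk _ x), rfl⟩
        · exact ⟨Sum.inr (Quotient.mk _ x), rfl⟩ }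

/-- The empty `A`-fibered `G`-set. -/
def FibSet.empty (A G : Type u) [CommGroup A] [Group G] : FibSet A G :=
  letI actG : MulAction G (PEmpty) := { smul := fun _ x => x, one_smul := fun _ => rfl, mul_smul := fun _ _ _ => rfl }
  letI actA : MulAction A (PEmpty) := { smul := fun _ x => x, one_smul := fun _ => rfl, mul_smul := fun _ _ _ => rfl }
  { carrier := PEmpty
    actG := actG
    actA := actA
    comm := ⟨fun _ _ _ => rfl⟩
    free := fun _ _ x => x.elim
    finite := Finite.of_surjective (α := PEmpty) (fun x => x.elim) (by rintro ⟨x⟩; exact x.elim) }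

/-- An invariant subset of an `A`-fibered `G`-set. -/
def FibSet.restrict (X : FibSet A G) (p : X → Prop) (hG : ∀ (g : G) x, p x → p (g • x))
    (hA : ∀ (a : A) x, p x → p (a • x)) : FibSet A G :=
  letI actG : MulAction G ({x // p x}) :=
    { smul := fun g x => ⟨g • x.1, hG g _ x.2⟩
      one_smul := fun x => Subtype.ext (one_smul _ _)
      mul_smul := fun g h x => Subtype.ext (mul_smul _ _ _) }
  letI actA : MulAction A ({x // p x}) :=
    { smul := fun g x => ⟨g • x.1, hA g _ x.2⟩
      one_smul := fun x => Subtype.ext (one_smul _ _)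
      mul_smul := fun g h x => Subtype.ext (mul_smul _ _ _) }
  { carrier := {x // p x}
    actG := actG
    actA := actA
    comm := ⟨fun g a x => Subtype.ext (smul_comm g a x.1)⟩
    free := fun a b x h => X.free a b x.1 (congrArg Subtype.val h)
    finite := by
      refine Finite.of_injective (β := MulAction.orbitRel.Quotient A X)
        (Quotient.lift (fun x => Quotient.mk _ x.1) ?_) ?_
      · rintro x y ⟨a, rfl⟩
        exact Quotient.sound ⟨a, rfl⟩
      · rintro ⟨x⟩ ⟨y⟩ h
        obtain ⟨a, ha⟩ := Quotient.exact h
        exact Quotient.sound ⟨a, Subtype.ext ha⟩ }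

end Basic

/-! ### Tensor products -/

section Tensor

variable {A M H : Type u} [CommGroup A] [Group M] [Group H]

/-- `(x, y)` and `(x (h a)⁻¹, h a y)` are identified; here `x h⁻¹` is the left action of `(1, h)`. -/
def tensSetoid (X Y : FibSet A (M × H)) : Setoid (X × Y) where
  r p q := ∃ (h : H) (a : A),
    q.1 = a⁻¹ • ((1, h) : M × H) • p.1 ∧ q.2 = a • ((1, h) : M × H) • p.2
  iseqv :=
    { refl := fun p => ⟨1, 1, by simp [← Prod.one_eq_mk], by simp [← Prod.one_eq_mk]⟩
      symm := by
        rintro ⟨x, y⟩ ⟨x', y'⟩ ⟨h, a, h1, h2⟩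
        dsimp only at h1 h2
        subst h1 h2
        refine ⟨h⁻¹, a⁻¹, ?_, ?_⟩
        · rw [smul_comm _ a⁻¹, smul_smul, smul_smul]; simp [← Prod.one_eq_mk]
        · rw [smul_comm _ a, smul_smul, smul_smul]; simp [← Prod.one_eq_mk]
      trans := by
        rintro ⟨x, y⟩ ⟨x', y'⟩ ⟨x'', y''⟩ ⟨h, a, h1, h2⟩ ⟨k, b, h3, h4⟩
        dsimp only at h1 h2 h3 h4
        subst h1 h2 h3 h4
        refine ⟨k * h, b * a, ?_, ?_⟩
        · rw [smul_comm _ a⁻¹, smul_smul, smul_smul]; simp [mul_comm]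
        · rw [smul_comm _ a, smul_smul, smul_smul]; simp }

/-- The set of all `(H × A)`-orbits on `X × Y`. -/
def PreTens (X Y : FibSet A (M × H)) : Type u := Quotient (tensSetoid X Y)

def PreTens.mk {X Y : FibSet A (M × H)} (x : X) (y : Y) : PreTens X Y :=
  Quotient.mk (tensSetoid X Y) (x, y)

theorem PreTens.mk_eq {X Y : FibSet A (M × H)} {x x' : X} {y y' : Y} :
    PreTens.mk x y = PreTens.mk x' y' ↔ ∃ (h : H) (a : A),
      x' = a⁻¹ • ((1, h) : M × H) • x ∧ y' = a • ((1, h) : M × H) • y :=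
  ⟨fun h => Quotient.exact h, fun h => Quotient.sound h⟩

theorem PreTens.ind {X Y : FibSet A (M × H)} {p : PreTens X Y → Prop}
    (h : ∀ x y, p (PreTens.mk x y)) (q : PreTens X Y) : p q := by
  obtain ⟨x, y⟩ := q
  exact h x y

instance (X Y : FibSet A (M × H)) : MulAction M (PreTens X Y) where
  smul m := Quotient.lift
    (fun p => PreTens.mk (((m, 1) : M × H) • p.1) (((m, 1) : M × H) • p.2)) (by
      rintro ⟨x, y⟩ ⟨x', y'⟩ ⟨h, a, h1, h2⟩
      dsimp only at h1 h2
      subst h1 h2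
      refine PreTens.mk_eq.2 ⟨h, a, ?_, ?_⟩
      · rw [smul_comm _ a⁻¹, smul_smul, smul_smul]; simp
      · rw [smul_comm _ a, smul_smul, smul_smul]; simp)
  one_smul := PreTens.ind fun x y => by
    change PreTens.mk (((1, 1) : M × H) • x) (((1, 1) : M × H) • y) = _
    rw [← Prod.one_eq_mk, one_smul, one_smul]
  mul_smul m n := PreTens.ind fun x y => by
    change PreTens.mk (((m * n, 1) : M × H) • x) (((m * n, 1) : M × H) • y) =
      PreTens.mk (((m, 1) : M × H) • ((n, 1) : M × H) • x)
        (((m, 1) : M × H) • ((n, 1) : M × H) • y)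
    rw [smul_smul, smul_smul]; simp

instance (X Y : FibSet A (M × H)) : MulAction A (PreTens X Y) where
  smul c := Quotient.lift (fun p => PreTens.mk (c • p.1) p.2) (by
      rintro ⟨x, y⟩ ⟨x', y'⟩ ⟨h, a, h1, h2⟩
      dsimp only at h1 h2
      subst h1 h2
      refine PreTens.mk_eq.2 ⟨h, a, ?_, rfl⟩
      rw [smul_comm _ c, smul_smul, smul_smul, mul_comm])
  one_smul := PreTens.ind fun x y => by
    change PreTens.mk ((1 : A) • x) y = _
    rw [one_smul]
  mul_smul a b := PreTens.ind fun x y => by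
    change PreTens.mk ((a * b) • x) y = PreTens.mk (a • b • x) y
    rw [mul_smul]

theorem PreTens.smul_mk {X Y : FibSet A (M × H)} (m : M) (x : X) (y : Y) :
    m • PreTens.mk x y = PreTens.mk (((m, 1) : M × H) • x) (((m, 1) : M × H) • y) := rfl

theorem PreTens.smulA_mk {X Y : FibSet A (M × H)} (a : A) (x : X) (y : Y) :
    a • PreTens.mk x y = PreTens.mk (a • x) y := rfl

theorem PreTens.smulA_mk' {X Y : FibSet A (M × H)} (a : A) (x : X) (y : Y) :
    a • PreTens.mk x y = PreTens.mk x (a • y) :=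
  PreTens.mk_eq.2 ⟨1, a, by simp [← Prod.one_eq_mk], by simp [← Prod.one_eq_mk]⟩

instance (X Y : FibSet A (M × H)) : SMulCommClass M A (PreTens X Y) where
  smul_comm m a := PreTens.ind fun x y => by
    rw [PreTens.smulA_mk, PreTens.smul_mk, PreTens.smul_mk, PreTens.smulA_mk, smul_comm]

/-- The orbit is `A`-free under the induced `A`-action. -/
def PreTens.Free {X Y : FibSet A (M × H)} (q : PreTens X Y) : Prop :=
  ∀ a b : A, a • q = b • q → a = b

theorem PreTens.free_iff {X Y : FibSet A (M × H)} {q : PreTens X Y} :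
    q.Free ↔ ∀ a : A, a • q = q → a = 1 := by
  refine ⟨fun h a ha => h a 1 (by rw [ha, one_smul]), fun h a b hab => ?_⟩
  have := h (b⁻¹ * a) (by rw [mul_smul, hab, smul_smul, inv_mul_cancel, one_smul])
  exact (inv_mul_eq_one.1 this).symm

theorem PreTens.Free.smul {X Y : FibSet A (M × H)} {q : PreTens X Y} (h : q.Free) (m : M) :
    (m • q).Free := fun a b hab => h a b (by
  rw [← smul_comm, ← smul_comm m b] at hab
  exact (MulAction.injective m) hab)

theorem PreTens.Free.smulA {X Y : FibSet A (M × H)} {q : PreTens X Y} (h : q.Free) (m : A) :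
    (m • q).Free := fun a b hab => h a b (by
  rw [← smul_comm m a, ← smul_comm m b] at hab
  exact (MulAction.injective m) hab)

/-- For `X` and `Y` with actions of `M × H` and of `A`, the `A`-fibered `M`-set of those
`(H × A)`-orbits of `X × Y` that are `A`-free, with the diagonal action of `M`. -/
def FibSet.tens (X Y : FibSet A (M × H)) : FibSet A M :=
  letI actG : MulAction M ({q : PreTens X Y // q.Free}) :=
    { smul := fun g x => ⟨g • x.1, x.2.smul g⟩
      one_smul := fun x => Subtype.ext (one_smul _ _)
      mul_smul := fun g h x => Subtype.ext (mul_smul _ _ _) }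
  letI actA : MulAction A ({q : PreTens X Y // q.Free}) :=
    { smul := fun g x => ⟨g • x.1, x.2.smulA g⟩
      one_smul := fun x => Subtype.ext (one_smul _ _)
      mul_smul := fun g h x => Subtype.ext (mul_smul _ _ _) }
  { carrier := {q : PreTens X Y // q.Free}
    actG := actG
    actA := actA
    comm := ⟨fun g a x => Subtype.ext (smul_comm g a x.1)⟩
    free := fun a b x h => x.2 a b (congrArg Subtype.val h)
    finite := by
      let f : MulAction.orbitRel.Quotient A X × MulAction.orbitRel.Quotient A Y →
          MulAction.orbitRel.Quotient A (PreTens X Y) :=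
        fun p => Quotient.mk _ (PreTens.mk p.1.out p.2.out)
      have hf : Function.Surjective f := by
        rintro ⟨q⟩
        induction q using PreTens.ind with
        | _ x y =>
          refine ⟨(Quotient.mk _ x, Quotient.mk _ y), Quotient.sound ?_⟩
          obtain ⟨a, ha⟩ := Quotient.mk_out (s := MulAction.orbitRel A X) x
          obtain ⟨b, hb⟩ := Quotient.mk_out (s := MulAction.orbitRel A Y) y
          refine ⟨a * b, ?_⟩
          dsimp only at ha hb ⊢
          rw [← ha, ← hb, mul_smul, PreTens.smulA_mk', PreTens.smulA_mk]
      have := Finite.of_surjective f hf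
      refine Finite.of_injective (β := MulAction.orbitRel.Quotient A (PreTens X Y))
        (Quotient.lift (fun x => Quotient.mk _ x.1) ?_) ?_
      · rintro x y ⟨a, rfl⟩
        exact Quotient.sound ⟨a, rfl⟩
      · rintro ⟨x⟩ ⟨y⟩ h
        obtain ⟨a, ha⟩ := Quotient.exact h
        exact Quotient.sound ⟨a, Subtype.ext ha⟩ }

/-- The tensor is functorial for isomorphisms. -/
theorem FibSet.tens_isom {X X' Y Y' : FibSet A (M × H)} (hX : FibSet.Isom X X')
    (hY : FibSet.Isom Y Y') : FibSet.Isom (X.tens Y) (X'.tens Y') := by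
  obtain ⟨f, hf⟩ := hX
  obtain ⟨g, hg⟩ := hY
  have key : ∀ x x' y y', PreTens.mk x y = PreTens.mk x' y' ↔
      PreTens.mk (f x) (g y) = PreTens.mk (f x') (g y') := by
    intro x x' y y'
    rw [PreTens.mk_eq, PreTens.mk_eq]
    refine exists_congr fun h => exists_congr fun a => ?_
    rw [← f.map_smul, ← f.map_smulA, ← g.map_smul, ← g.map_smulA, hf.1.eq_iff, hg.1.eq_iff]
  have hfree : ∀ x y, (PreTens.mk x y).Free ↔ (PreTens.mk (f x) (g y)).Free := by
    intro x y
    refine forall_congr' fun a => forall_congr' fun b => ?_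
    rw [PreTens.smulA_mk, PreTens.smulA_mk, PreTens.smulA_mk, PreTens.smulA_mk, key,
      f.map_smulA, f.map_smulA]
  refine .of_param (T := {p : X × Y // (PreTens.mk p.1 p.2).Free})
    (fun p => ⟨PreTens.mk p.1.1 p.1.2, p.2⟩)
    (fun p => ⟨PreTens.mk (f p.1.1) (g p.1.2), (hfree _ _).1 p.2⟩) ?_ ?_ ?_ ?_ ?_
  · rintro ⟨⟨x, y⟩, hq⟩
    exact ⟨⟨(x, y), hq⟩, rfl⟩
  · rintro ⟨⟨x, y⟩, hq⟩
    obtain ⟨x, rfl⟩ := hf.2 x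
    obtain ⟨y, rfl⟩ := hg.2 y
    exact ⟨⟨(x, y), (hfree _ _).2 hq⟩, rfl⟩
  · rintro ⟨p, hp⟩ ⟨q, hq⟩
    exact ⟨fun h => Subtype.ext ((key _ _ _ _).1 (congrArg Subtype.val h)),
      fun h => Subtype.ext ((key _ _ _ _).2 (congrArg Subtype.val h))⟩
  · rintro m ⟨⟨x, y⟩, hp⟩
    refine ⟨⟨(((m, 1) : M × H) • x, ((m, 1) : M × H) • y), hp.smul m⟩, rfl, Subtype.ext ?_⟩
    change PreTens.mk (f _) (g _) = _
    rw [f.map_smul, g.map_smul]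
    rfl
  · rintro a ⟨⟨x, y⟩, hp⟩
    refine ⟨⟨(a • x, y), hp.smulA a⟩, rfl, Subtype.ext ?_⟩
    change PreTens.mk (f _) _ = _
    rw [f.map_smulA]
    rfl

end Tensor

section BisetTensor

variable {A G H K L : Type u} [CommGroup A] [Group G] [Group H] [Group K] [Group L]

/-- The tensor product `U ⊗_{AH} V` of an `A`-fibered `(G, H)`-biset and an `A`-fibered
`(H, K)`-biset. In fibered biset notation `g u h = (g, h⁻¹) • u`. -/
def FibSet.bisetTens (U : FibSet A (G × H)) (V : FibSet A (H × K)) : FibSet A (G × K) :=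
  (U.comap (((MonoidHom.fst G K).comp (MonoidHom.fst (G × K) H)).prod
    (MonoidHom.snd (G × K) H))).tens
    (V.comap ((MonoidHom.snd (G × K) H).prod
      ((MonoidHom.snd G K).comp (MonoidHom.fst (G × K) H))))

/-- The tensor product `U ⊗_{AH} X` of an `A`-fibered `(G, H)`-biset and an `A`-fibered
`H`-set. -/
def FibSet.actTens (U : FibSet A (G × H)) (X : FibSet A H) : FibSet A G :=
  U.tens (X.comap (MonoidHom.snd G H))

theorem FibSet.tens_sum_left (X X' Y : FibSet A (G × H)) :
    FibSet.Isom ((X.sum X').tens Y) ((X.tens Y).sum (X'.tens Y)) := by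
  have hl : ∀ (x x' : X) (y y' : Y),
      (PreTens.mk (X := X.sum X') (Sum.inl x) y = PreTens.mk (X := X.sum X') (Sum.inl x') y') ↔
      PreTens.mk x y = PreTens.mk x' y' := by
    intro x x' y y'
    exact PreTens.mk_eq.trans (Iff.trans (exists_congr fun h => exists_congr fun a =>
      and_congr_left' Sum.inl_injective.eq_iff) PreTens.mk_eq.symm)
  have hr : ∀ (x x' : X') (y y' : Y),
      (PreTens.mk (X := X.sum X') (Sum.inr x) y = PreTens.mk (X := X.sum X') (Sum.inr x') y') ↔
      PreTens.mk x y = PreTens.mk x' y' := by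
    intro x x' y y'
    exact PreTens.mk_eq.trans (Iff.trans (exists_congr fun h => exists_congr fun a =>
      and_congr_left' Sum.inr_injective.eq_iff) PreTens.mk_eq.symm)
  have hfl : ∀ (x : X) (y : Y), (PreTens.mk (X := X.sum X') (Sum.inl x) y).Free ↔
      (PreTens.mk x y).Free := fun x y =>
    forall_congr' fun a => forall_congr' fun b => imp_congr_left (hl (a • x) (b • x) y y)
  have hfr : ∀ (x : X') (y : Y), (PreTens.mk (X := X.sum X') (Sum.inr x) y).Free ↔
      (PreTens.mk x y).Free := fun x y =>
    forall_congr' fun a => forall_congr' fun b => imp_congr_left (hr (a • x) (b • x) y y)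
  refine .of_param (T := {p : X × Y // (PreTens.mk p.1 p.2).Free} ⊕
      {p : X' × Y // (PreTens.mk p.1 p.2).Free})
    (Sum.elim (fun p => ⟨PreTens.mk (X := X.sum X') (Sum.inl p.1.1) p.1.2, (hfl _ _).2 p.2⟩)
      (fun p => ⟨PreTens.mk (X := X.sum X') (Sum.inr p.1.1) p.1.2, (hfr _ _).2 p.2⟩))
    (Sum.elim (fun p => Sum.inl ⟨PreTens.mk p.1.1 p.1.2, p.2⟩)
      (fun p => Sum.inr ⟨PreTens.mk p.1.1 p.1.2, p.2⟩)) ?_ ?_ ?_ ?_ ?_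
  · rintro ⟨⟨x | x, y⟩, hq⟩
    · exact ⟨Sum.inl ⟨(x, y), (hfl _ _).1 hq⟩, rfl⟩
    · exact ⟨Sum.inr ⟨(x, y), (hfr _ _).1 hq⟩, rfl⟩
  · rintro (⟨⟨x, y⟩, hq⟩ | ⟨⟨x, y⟩, hq⟩)
    · exact ⟨Sum.inl ⟨(x, y), hq⟩, rfl⟩
    · exact ⟨Sum.inr ⟨(x, y), hq⟩, rfl⟩
  · rintro (⟨⟨x, y⟩, hq⟩ | ⟨⟨x, y⟩, hq⟩) (⟨⟨x', y'⟩, hq'⟩ | ⟨⟨x', y'⟩, hq'⟩)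
    · exact Subtype.ext_iff.trans ((hl x x' y y').trans
        (Subtype.ext_iff (a1 := ⟨_, hq⟩) (a2 := ⟨_, hq'⟩)).symm) |>.trans
          Sum.inl_injective.eq_iff.symm
    · refine iff_of_false (fun h => ?_) (fun h => by cases h)
      obtain ⟨h, a, h1, -⟩ := PreTens.mk_eq.1 (congrArg Subtype.val h)
      cases h1
    · refine iff_of_false (fun h => ?_) (fun h => by cases h)
      obtain ⟨h, a, h1, -⟩ := PreTens.mk_eq.1 (congrArg Subtype.val h)
      cases h1
    · exact Subtype.ext_iff.trans ((hr x x' y y').trans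
        (Subtype.ext_iff (a1 := ⟨_, hq⟩) (a2 := ⟨_, hq'⟩)).symm) |>.trans
          Sum.inr_injective.eq_iff.symm
  · rintro m (⟨⟨x, y⟩, hq⟩ | ⟨⟨x, y⟩, hq⟩)
    · exact ⟨Sum.inl ⟨(_, _), hq.smul m⟩, rfl, rfl⟩
    · exact ⟨Sum.inr ⟨(_, _), hq.smul m⟩, rfl, rfl⟩
  · rintro m (⟨⟨x, y⟩, hq⟩ | ⟨⟨x, y⟩, hq⟩)
    · exact ⟨Sum.inl ⟨(m • x, y), hq.smulA m⟩, rfl, rfl⟩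
    · exact ⟨Sum.inr ⟨(m • x, y), hq.smulA m⟩, rfl, rfl⟩

theorem FibSet.tens_comm (X Y : FibSet A (G × H)) : FibSet.Isom (X.tens Y) (Y.tens X) := by
  have hl : ∀ (x x' : X) (y y' : Y), PreTens.mk x y = PreTens.mk x' y' ↔
      PreTens.mk y x = PreTens.mk y' x' := by
    intro x x' y y'
    rw [PreTens.mk_eq, PreTens.mk_eq]
    refine exists_congr fun h => ⟨?_, ?_⟩
    · rintro ⟨a, h1, h2⟩
      exact ⟨a⁻¹, by rwa [inv_inv], h1⟩
    · rintro ⟨a, h1, h2⟩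
      exact ⟨a⁻¹, by rwa [inv_inv], h1⟩
  have hf : ∀ (x : X) (y : Y), (PreTens.mk x y).Free ↔ (PreTens.mk y x).Free := fun x y =>
    forall_congr' fun a => forall_congr' fun b => imp_congr_left (by
      rw [PreTens.smulA_mk, PreTens.smulA_mk, PreTens.smulA_mk', PreTens.smulA_mk']
      exact hl _ _ _ _)
  refine .of_param (T := {p : X × Y // (PreTens.mk p.1 p.2).Free})
    (fun p => ⟨PreTens.mk p.1.1 p.1.2, p.2⟩)
    (fun p => ⟨PreTens.mk p.1.2 p.1.1, (hf _ _).1 p.2⟩) ?_ ?_ ?_ ?_ ?_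
  · rintro ⟨⟨x, y⟩, hq⟩
    exact ⟨⟨(x, y), hq⟩, rfl⟩
  · rintro ⟨⟨x, y⟩, hq⟩
    exact ⟨⟨(y, x), (hf _ _).2 hq⟩, rfl⟩
  · rintro ⟨⟨x, y⟩, hq⟩ ⟨⟨x', y'⟩, hq'⟩
    exact ⟨fun h => Subtype.ext ((hl _ _ _ _).1 (congrArg Subtype.val h)),
      fun h => Subtype.ext ((hl _ _ _ _).2 (congrArg Subtype.val h))⟩
  · rintro m ⟨⟨x, y⟩, hq⟩
    exact ⟨⟨(_, _), hq.smul m⟩, rfl, rfl⟩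
  · rintro m ⟨⟨x, y⟩, hq⟩
    exact ⟨⟨(m • x, y), hq.smulA m⟩, rfl, Subtype.ext (PreTens.smulA_mk' m y x).symm⟩

theorem FibSet.sum_isom {X X' Y Y' : FibSet A G} (hX : FibSet.Isom X X')
    (hY : FibSet.Isom Y Y') : FibSet.Isom (X.sum Y) (X'.sum Y') := by
  obtain ⟨f, hf⟩ := hX
  obtain ⟨g, hg⟩ := hY
  refine ⟨⟨Sum.map f g, ?_, ?_⟩, hf.sumMap hg⟩
  · rintro m (x | x)
    · exact congrArg Sum.inl (f.map_smul m x)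
    · exact congrArg Sum.inr (g.map_smul m x)
  · rintro m (x | x)
    · exact congrArg Sum.inl (f.map_smulA m x)
    · exact congrArg Sum.inr (g.map_smulA m x)

theorem FibSet.comap_isom (f : G →* H) {X X' : FibSet A H} (hX : FibSet.Isom X X') :
    FibSet.Isom (X.comap f) (X'.comap f) := by
  obtain ⟨e, he⟩ := hX
  exact ⟨⟨e, fun m x => e.map_smul (f m) x, e.map_smulA⟩, he⟩

theorem FibSet.comap_sum (f : G →* H) (X Y : FibSet A H) :
    FibSet.Isom ((X.sum Y).comap f) ((X.comap f).sum (Y.comap f)) :=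
  ⟨⟨fun x => x, by rintro m (x | x) <;> rfl, by rintro m (x | x) <;> rfl⟩, Function.bijective_id⟩

theorem FibSet.isom_of_isEmpty (X Y : FibSet A G) [IsEmpty X] [IsEmpty Y] : FibSet.Isom X Y :=
  ⟨⟨fun x => isEmptyElim x, fun _ x => isEmptyElim x, fun _ x => isEmptyElim x⟩,
    fun x => isEmptyElim x, fun x => isEmptyElim x⟩

instance : IsEmpty (FibSet.empty A G) := inferInstanceAs (IsEmpty PEmpty)

theorem FibSet.bisetTens_isom {U U' : FibSet A (G × H)} {V V' : FibSet A (H × K)}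
    (hU : FibSet.Isom U U') (hV : FibSet.Isom V V') :
    FibSet.Isom (U.bisetTens V) (U'.bisetTens V') :=
  FibSet.tens_isom (FibSet.comap_isom _ hU) (FibSet.comap_isom _ hV)

theorem FibSet.bisetTens_sum_left (U U' : FibSet A (G × H)) (V : FibSet A (H × K)) :
    FibSet.Isom ((U.sum U').bisetTens V) ((U.bisetTens V).sum (U'.bisetTens V)) :=
  (FibSet.tens_isom (FibSet.comap_sum _ _ _) (.refl _)).trans (FibSet.tens_sum_left _ _ _)

theorem FibSet.bisetTens_sum_right (U : FibSet A (G × H)) (V V' : FibSet A (H × K)) :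
    FibSet.Isom (U.bisetTens (V.sum V')) ((U.bisetTens V).sum (U.bisetTens V')) :=
  (FibSet.tens_isom (.refl _) (FibSet.comap_sum _ _ _)).trans <|
    (FibSet.tens_comm _ _).trans <| (FibSet.tens_sum_left _ _ _).trans <|
      FibSet.sum_isom (FibSet.tens_comm _ _) (FibSet.tens_comm _ _)

theorem FibSet.bisetTens_empty_left (V : FibSet A (H × K)) :
    FibSet.Isom ((FibSet.empty A (G × H)).bisetTens V) (FibSet.empty A (G × K)) := by
  have : IsEmpty ((FibSet.empty A (G × H)).bisetTens V) :=
    ⟨by rintro ⟨⟨x, y⟩, -⟩; exact PEmpty.elim x⟩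
  exact FibSet.isom_of_isEmpty _ _

theorem FibSet.bisetTens_empty_right (U : FibSet A (G × H)) :
    FibSet.Isom (U.bisetTens (FibSet.empty A (H × K))) (FibSet.empty A (G × K)) := by
  have : IsEmpty (U.bisetTens (FibSet.empty A (H × K))) :=
    ⟨by rintro ⟨⟨x, y⟩, -⟩; exact PEmpty.elim y⟩
  exact FibSet.isom_of_isEmpty _ _

/-- The orbit of `(u, v)`, before the condition of `A`-freeness. -/
def FibSet.bmk (U : FibSet A (G × H)) (V : FibSet A (H × K)) (u : U) (v : V) :
    PreTens (U.comap (((MonoidHom.fst G K).comp (MonoidHom.fst (G × K) H)).prod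
      (MonoidHom.snd (G × K) H)))
    (V.comap ((MonoidHom.snd (G × K) H).prod
      ((MonoidHom.snd G K).comp (MonoidHom.fst (G × K) H)))) :=
  PreTens.mk (show U.comap _ from u) (show V.comap _ from v)

theorem FibSet.bmk_eq {U : FibSet A (G × H)} {V : FibSet A (H × K)} {u u' : U} {v v' : V} :
    U.bmk V u v = U.bmk V u' v' ↔ ∃ (h : H) (a : A),
      u' = a⁻¹ • ((1, h) : G × H) • u ∧ v' = a • ((h, 1) : H × K) • v :=
  PreTens.mk_eq

theorem FibSet.bmk_smul {U : FibSet A (G × H)} {V : FibSet A (H × K)} (g : G) (k : K)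
    (u : U) (v : V) : ((g, k) : G × K) • U.bmk V u v =
      U.bmk V (((g, 1) : G × H) • u) (((1, k) : H × K) • v) := rfl

theorem FibSet.bmk_smulA {U : FibSet A (G × H)} {V : FibSet A (H × K)} (a : A)
    (u : U) (v : V) : a • U.bmk V u v = U.bmk V (a • u) v := rfl

theorem FibSet.bmk_free {U : FibSet A (G × H)} {V : FibSet A (H × K)} {u : U} {v : V} :
    (U.bmk V u v).Free ↔ ∀ (h : H) (a c : A), c • u = a⁻¹ • ((1, h) : G × H) • u →
      v = a • ((h, 1) : H × K) • v → c = 1 := by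
  rw [PreTens.free_iff]
  constructor
  · intro hf h a c h1 h2
    refine hf c ?_
    rw [FibSet.bmk_smulA, eq_comm, FibSet.bmk_eq]
    exact ⟨h, a, h1, h2⟩
  · intro hf c hc
    rw [FibSet.bmk_smulA, eq_comm, FibSet.bmk_eq] at hc
    obtain ⟨h, a, h1, h2⟩ := hc
    exact hf h a c h1 h2

/-- The element `u ⊗ v`, for a pair whose orbit is `A`-free. -/
def FibSet.btmk {U : FibSet A (G × H)} {V : FibSet A (H × K)} (u : U) (v : V)
    (h : (U.bmk V u v).Free) : U.bisetTens V := ⟨U.bmk V u v, h⟩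

theorem FibSet.btmk_eq {U : FibSet A (G × H)} {V : FibSet A (H × K)} {u u' : U} {v v' : V}
    {h : (U.bmk V u v).Free} {h' : (U.bmk V u' v').Free} :
    FibSet.btmk u v h = FibSet.btmk u' v' h' ↔ ∃ (h : H) (a : A),
      u' = a⁻¹ • ((1, h) : G × H) • u ∧ v' = a • ((h, 1) : H × K) • v :=
  Subtype.ext_iff.trans FibSet.bmk_eq

theorem FibSet.btmk_surj {U : FibSet A (G × H)} {V : FibSet A (H × K)} (q : U.bisetTens V) :
    ∃ u v h, FibSet.btmk u v h = q := by
  obtain ⟨⟨u, v⟩, h⟩ := q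
  exact ⟨u, v, h, rfl⟩

/-- The tensor product is associative. -/
theorem FibSet.bisetTens_assoc (U : FibSet A (G × H)) (V : FibSet A (H × K))
    (W : FibSet A (K × L)) :
    FibSet.Isom ((U.bisetTens V).bisetTens W) (U.bisetTens (V.bisetTens W)) := by
  let R : U → V → W → U → V → W → Prop := fun u v w u' v' w' =>
    ∃ (h : H) (k : K) (b c : A), u' = b⁻¹ • ((1, h) : G × H) • u ∧
      v' = c⁻¹ • b • ((h, k) : H × K) • v ∧ w' = c • ((k, 1) : K × L) • w
  have h1 : ∀ u v w u' v' w' h h', (U.bisetTens V).bmk W (FibSet.btmk u v h) w =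
      (U.bisetTens V).bmk W (FibSet.btmk u' v' h') w' ↔ R u v w u' v' w' := by
    intro u v w u' v' w' hh hh'
    rw [FibSet.bmk_eq]
    constructor
    · rintro ⟨k, c, e1, e2⟩
      obtain ⟨h, b, e3, e4⟩ := FibSet.bmk_eq.1 ((congrArg Subtype.val e1).trans
        (PreTens.smulA_mk' (c⁻¹) _ _)).symm
      have e3 : u' = b⁻¹ • ((1, h) : G × H) • (1 : G × H) • u := by
        rw [Prod.one_eq_mk]; exact e3
      have e4 : v' = b • ((h, 1) : H × K) • c⁻¹ • ((1, k) : H × K) • v := e4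
      refine ⟨h, k, b, c, by rwa [one_smul] at e3, ?_, e2⟩
      have : ((h, k) : H × K) = ((h, 1) : H × K) * ((1, k) : H × K) := by simp
      rw [e4, this, mul_smul, smul_comm _ c⁻¹, smul_comm b]
    · rintro ⟨h, k, b, c, e1, e2, e3⟩
      refine ⟨k, c, ?_, e3⟩
      refine Subtype.ext (Eq.trans ?_ (PreTens.smulA_mk' (c⁻¹) _ _).symm)
      refine (FibSet.bmk_eq (u' := u') (v' := v')
        (u := ((1, 1) : G × H) • u) (v := c⁻¹ • ((1, k) : H × K) • v)).2
        ⟨h, b, ?_, ?_⟩ |>.symm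
      · rw [e1, ← Prod.one_eq_mk, one_smul]
      · have : ((h, k) : H × K) = ((h, 1) : H × K) * ((1, k) : H × K) := by simp
        rw [e2, this, mul_smul, smul_comm c⁻¹ b, smul_comm c⁻¹]
  have h2 : ∀ u v w u' v' w' h h', U.bmk (V.bisetTens W) u (FibSet.btmk v w h) =
      U.bmk (V.bisetTens W) u' (FibSet.btmk v' w' h') ↔ R u v w u' v' w' := by
    intro u v w u' v' w' hh hh'
    rw [FibSet.bmk_eq]
    constructor
    · rintro ⟨h, b, e1, e2⟩
      obtain ⟨k, c, e3, e4⟩ := FibSet.bmk_eq.1 (congrArg Subtype.val e2).symm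
      have e4 : w' = c • ((k, 1) : K × L) • (1 : K × L) • w := by
        rw [Prod.one_eq_mk]; exact e4
      have e3 : v' = c⁻¹ • ((1, k) : H × K) • b • ((h, 1) : H × K) • v := e3
      refine ⟨h, k, b, c, e1, ?_, by rwa [one_smul] at e4⟩
      have : ((h, k) : H × K) = ((1, k) : H × K) * ((h, 1) : H × K) := by simp
      rw [e3, this, mul_smul, smul_comm _ b]
    · rintro ⟨h, k, b, c, e1, e2, e3⟩
      refine ⟨h, b, e1, Subtype.ext ?_⟩
      refine (FibSet.bmk_eq (u' := v') (v' := w')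
        (u := b • ((h, 1) : H × K) • v) (v := ((1, 1) : K × L) • w)).2
        ⟨k, c, ?_, ?_⟩ |>.symm
      · have : ((h, k) : H × K) = ((1, k) : H × K) * ((h, 1) : H × K) := by simp
        rw [e2, this, mul_smul, smul_comm b]
      · rw [e3, ← Prod.one_eq_mk, one_smul]
  let F : U → V → W → Prop := fun u v w => ∀ a : A, R (a • u) v w u v w → a = 1
  have f1 : ∀ u v w, F u v w ↔ ∃ h, ((U.bisetTens V).bmk W (FibSet.btmk u v h) w).Free := by
    intro u v w
    constructor
    · intro hF
      have h : (U.bmk V u v).Free := by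
        refine PreTens.free_iff.2 fun a ha => hF a ?_
        rw [FibSet.bmk_smulA, FibSet.bmk_eq] at ha
        obtain ⟨h, b, e1, e2⟩ := ha
        exact ⟨h, 1, b, 1, e1, by simpa using e2, by simp [← Prod.one_eq_mk]⟩
      exact ⟨h, PreTens.free_iff.2 fun a ha => hF a ((h1 _ _ _ _ _ _ (h.smulA a) h).1 ha)⟩
    · rintro ⟨h, hF⟩ a ha
      exact PreTens.free_iff.1 hF a ((h1 _ _ _ _ _ _ (h.smulA a) h).2 ha)
  have f2 : ∀ u v w, F u v w ↔ ∃ h, (U.bmk (V.bisetTens W) u (FibSet.btmk v w h)).Free := by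
    intro u v w
    constructor
    · intro hF
      have h : (V.bmk W v w).Free := by
        refine PreTens.free_iff.2 fun a ha => hF a ?_
        rw [FibSet.bmk_smulA, FibSet.bmk_eq] at ha
        obtain ⟨k, c, e1, e2⟩ := ha
        refine ⟨1, k, a, c, by simp [← Prod.one_eq_mk], ?_, e2⟩
        rwa [smul_comm _ a] at e1
      exact ⟨h, PreTens.free_iff.2 fun a ha => hF a ((h2 _ _ _ _ _ _ h h).1 ha)⟩
    · rintro ⟨h, hF⟩ a ha
      exact PreTens.free_iff.1 hF a ((h2 _ _ _ _ _ _ h h).2 ha)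
  refine .of_param (T := {p : U × V × W // F p.1 p.2.1 p.2.2})
    (fun p => FibSet.btmk (FibSet.btmk p.1.1 p.1.2.1 ((f1 _ _ _).1 p.2).1) p.1.2.2
      ((f1 _ _ _).1 p.2).2)
    (fun p => FibSet.btmk p.1.1 (FibSet.btmk p.1.2.1 p.1.2.2 ((f2 _ _ _).1 p.2).1)
      ((f2 _ _ _).1 p.2).2) ?_ ?_ ?_ ?_ ?_
  · intro q
    obtain ⟨q, w, hw, rfl⟩ := FibSet.btmk_surj q
    obtain ⟨u, v, hv, rfl⟩ := FibSet.btmk_surj q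
    exact ⟨⟨(u, v, w), (f1 _ _ _).2 ⟨hv, hw⟩⟩, rfl⟩
  · intro q
    obtain ⟨u, q, hw, rfl⟩ := FibSet.btmk_surj q
    obtain ⟨v, w, hv, rfl⟩ := FibSet.btmk_surj q
    exact ⟨⟨(u, v, w), (f2 _ _ _).2 ⟨hv, hw⟩⟩, rfl⟩
  · rintro ⟨⟨u, v, w⟩, hp⟩ ⟨⟨u', v', w'⟩, hp'⟩
    exact ⟨fun h => Subtype.ext ((h2 _ _ _ _ _ _ _ _).2 ((h1 _ _ _ _ _ _ _ _).1
        (congrArg Subtype.val h))), fun h => Subtype.ext ((h1 _ _ _ _ _ _ _ _).2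
        ((h2 _ _ _ _ _ _ _ _).1 (congrArg Subtype.val h)))⟩
  · rintro ⟨g, l⟩ ⟨⟨u, v, w⟩, hp⟩
    obtain ⟨hq, hq'⟩ := (f1 _ _ _).1 hp
    have e := hq'.smul ((g, l) : G × L)
    have E1 : ((g, 1) : G × K) • U.bmk V u v = U.bmk V (((g, 1) : G × H) • u) v :=
      congrArg (fun t => U.bmk V _ t) (one_smul (H × K) v)
    have E2 : ((1, l) : H × L) • V.bmk W v w = V.bmk W v (((1, l) : K × L) • w) :=
      congrArg (fun t => V.bmk W t _) (one_smul (H × K) v)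
    have e1 : ((g, 1) : G × K) • FibSet.btmk u v hq = FibSet.btmk (((g, 1) : G × H) • u) v
        (E1 ▸ hq.smul ((g, 1) : G × K)) := Subtype.ext E1
    have e2 : ((1, l) : H × L) • FibSet.btmk v w ((f2 _ _ _).1 hp).1 =
        FibSet.btmk v (((1, l) : K × L) • w)
        (E2 ▸ ((f2 _ _ _).1 hp).1.smul ((1, l) : H × L)) := Subtype.ext E2
    rw [FibSet.bmk_smul, e1] at e
    refine ⟨⟨(((g, 1) : G × H) • u, v, ((1, l) : K × L) • w), (f1 _ _ _).2 ⟨_, e⟩⟩, ?_, ?_⟩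
    · refine Subtype.ext (Eq.trans ?_ (FibSet.bmk_smul _ _ _ _).symm)
      rw [e1]
      rfl
    · refine Subtype.ext (Eq.trans ?_ (FibSet.bmk_smul _ _ _ _).symm)
      rw [e2]
      rfl
  · rintro a ⟨⟨u, v, w⟩, hp⟩
    obtain ⟨hq, hq'⟩ := (f1 _ _ _).1 hp
    exact ⟨⟨(a • u, v, w), (f1 _ _ _).2 ⟨hq.smulA a, hq'.smulA a⟩⟩, rfl, rfl⟩

end BisetTensor

/-! ### Stabilizing pairs -/

/-- An element `(D, φ)` of `ℳ(G)`: a subgroup `D ≤ G` with a homomorphism `φ : D → A`. -/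
structure MPair (A G : Type u) [CommGroup A] [Group G] where
  D : Subgroup G
  φ : D →* A

section Pairs

variable {A G G' H K : Type u} [CommGroup A] [Group G] [Group G'] [Group H] [Group K]

theorem MPair.ext' {p q : MPair A G} (h : ∀ g, g ∈ p.D ↔ g ∈ q.D)
    (h' : ∀ g hp hq, p.φ ⟨g, hp⟩ = q.φ ⟨g, hq⟩) : p = q := by
  obtain ⟨D, φ⟩ := p
  obtain ⟨D', φ'⟩ := q
  obtain rfl : D = D' := Subgroup.ext h
  obtain rfl : φ = φ' := MonoidHom.ext fun g => h' g.1 g.2 g.2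
  rfl

/-- Transport of a pair along an injective homomorphism. -/
noncomputable def MPair.map (f : G →* G') (hf : Function.Injective f) (p : MPair A G) :
    MPair A G' where
  D := p.D.map f
  φ := p.φ.comp (p.D.equivMapOfInjective f hf).symm.toMonoidHom

theorem MPair.map_φ (f : G →* G') (hf : Function.Injective f) (p : MPair A G) (g : G)
    (hg : g ∈ p.D) (h : f g ∈ (p.map f hf).D) : (p.map f hf).φ ⟨f g, h⟩ = p.φ ⟨g, hg⟩ := by
  have : (⟨f g, h⟩ : p.D.map f) = p.D.equivMapOfInjective f hf ⟨g, hg⟩ := rfl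
  change p.φ ((p.D.equivMapOfInjective f hf).symm ⟨f g, h⟩) = _
  rw [this, MulEquiv.symm_apply_apply]

/-- Preimage of a pair. -/
def MPair.comap (f : G' →* G) (p : MPair A G) : MPair A G' where
  D := p.D.comap f
  φ := p.φ.comp (f.subgroupComap p.D)

/-- The conjugate pair `^g(D, φ)`. -/
noncomputable def MPair.conj (g : G) (p : MPair A G) : MPair A G :=
  p.map (MulAut.conj g).toMonoidHom (MulAut.conj g).injective

/-- The first projection `p₁(D)`. -/
def proj₁ (D : Subgroup (G × H)) : Subgroup G := D.map (MonoidHom.fst G H)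

/-- `D ∗ K = {g | ∃ h ∈ K, (g, h) ∈ D}` for `D ≤ G × H` and `K ≤ H`. -/
def starSet (D : Subgroup (G × H)) (K : Subgroup H) : Subgroup G where
  carrier := {g | ∃ h ∈ K, (g, h) ∈ D}
  one_mem' := ⟨1, K.one_mem, D.one_mem⟩
  mul_mem' := by
    rintro a b ⟨h, hh, hd⟩ ⟨h', hh', hd'⟩
    exact ⟨h * h', K.mul_mem hh hh', D.mul_mem hd hd'⟩
  inv_mem' := by
    rintro a ⟨h, hh, hd⟩
    exact ⟨h⁻¹, K.inv_mem hh, D.inv_mem hd⟩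

/-- `(D, φ)` and `(E, ψ)` are composable: `φ₂ = ψ₁` on `k₂(D) ∩ k₁(E)`, where
`φ₂(h) = φ(1, h)⁻¹` and `ψ₁(h) = ψ(h, 1)`. -/
def MPair.Compat (p : MPair A (G × H)) (q : MPair A (H × K)) : Prop :=
  ∀ (h : H) (h₁ : (1, h) ∈ p.D) (h₂ : (h, 1) ∈ q.D), (p.φ ⟨(1, h), h₁⟩)⁻¹ = q.φ ⟨(h, 1), h₂⟩

theorem MPair.Compat.eq {p : MPair A (G × H)} {q : MPair A (H × K)} (hc : p.Compat q)
    {g : G} {h h' : H} {k : K} (h₁ : (g, h) ∈ p.D) (h₂ : (h, k) ∈ q.D)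
    (h₁' : (g, h') ∈ p.D) (h₂' : (h', k) ∈ q.D) :
    p.φ ⟨(g, h), h₁⟩ * q.φ ⟨(h, k), h₂⟩ = p.φ ⟨(g, h'), h₁'⟩ * q.φ ⟨(h', k), h₂'⟩ := by
  have e1 : (1, h'⁻¹ * h) ∈ p.D := by
    simpa using p.D.mul_mem (p.D.inv_mem h₁') h₁
  have e2 : (h'⁻¹ * h, 1) ∈ q.D := by
    simpa using q.D.mul_mem (q.D.inv_mem h₂') h₂
  have := hc _ e1 e2
  have a1 : p.φ ⟨(1, h'⁻¹ * h), e1⟩ = (p.φ ⟨(g, h'), h₁'⟩)⁻¹ * p.φ ⟨(g, h), h₁⟩ := by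
    rw [← map_inv, ← map_mul]
    exact congrArg p.φ (Subtype.ext (by simp))
  have a2 : q.φ ⟨(h'⁻¹ * h, 1), e2⟩ = (q.φ ⟨(h', k), h₂'⟩)⁻¹ * q.φ ⟨(h, k), h₂⟩ := by
    rw [← map_inv, ← map_mul]
    exact congrArg q.φ (Subtype.ext (by simp))
  rw [a1, a2, mul_inv_rev, inv_inv, inv_mul_eq_iff_eq_mul] at this
  rw [this, mul_assoc, mul_comm (q.φ ⟨(h', k), h₂'⟩)⁻¹, inv_mul_cancel_right]

/-- The product `(D, φ) ∗ (E, ψ) = (D ∗ E, φ ∗ ψ)` of composable pairs, where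
`(φ ∗ ψ)(g, k) = φ(g, h) ψ(h, k)` for any `h` with `(g, h) ∈ D` and `(h, k) ∈ E`. -/
noncomputable def MPair.star (p : MPair A (G × H)) (q : MPair A (H × K)) (hc : p.Compat q) :
    MPair A (G × K) where
  D :=
    { carrier := {x | ∃ h, (x.1, h) ∈ p.D ∧ (h, x.2) ∈ q.D}
      one_mem' := ⟨1, p.D.one_mem, q.D.one_mem⟩
      mul_mem' := by
        rintro a b ⟨h, hh, hd⟩ ⟨h', hh', hd'⟩
        exact ⟨h * h', p.D.mul_mem hh hh', q.D.mul_mem hd hd'⟩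
      inv_mem' := by
        rintro a ⟨h, hh, hd⟩
        exact ⟨h⁻¹, p.D.inv_mem hh, q.D.inv_mem hd⟩ }
  φ := MonoidHom.mk'
    (fun x => p.φ ⟨(x.1.1, x.2.choose), x.2.choose_spec.1⟩ *
      q.φ ⟨(x.2.choose, x.1.2), x.2.choose_spec.2⟩) (by
        rintro ⟨⟨a, b⟩, hx⟩ ⟨⟨c, d⟩, hy⟩
        refine (hc.eq _ _ (p.D.mul_mem hx.choose_spec.1 hy.choose_spec.1)
          (q.D.mul_mem hx.choose_spec.2 hy.choose_spec.2)).trans ?_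
        rw [mul_mul_mul_comm, ← map_mul, ← map_mul]
        rfl)

theorem MPair.mem_star {p : MPair A (G × H)} {q : MPair A (H × K)} {hc : p.Compat q}
    {g : G} {k : K} : (g, k) ∈ (p.star q hc).D ↔ ∃ h, (g, h) ∈ p.D ∧ (h, k) ∈ q.D := Iff.rfl

theorem MPair.star_φ {p : MPair A (G × H)} {q : MPair A (H × K)} {hc : p.Compat q}
    {g : G} {h : H} {k : K} (h₁ : (g, h) ∈ p.D) (h₂ : (h, k) ∈ q.D)
    (h₃ : (g, k) ∈ (p.star q hc).D) :
    (p.star q hc).φ ⟨(g, k), h₃⟩ = p.φ ⟨(g, h), h₁⟩ * q.φ ⟨(h, k), h₂⟩ :=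
  hc.eq _ _ _ _

/-- The pair `(Δ(K), 1)` with `Δ(K) = {(k, k) | k ∈ K}`. -/
def MPair.delta (A : Type u) [CommGroup A] (K : Subgroup G) : MPair A (G × G) where
  D := K.map ((MonoidHom.id G).prod (MonoidHom.id G))
  φ := 1

theorem MPair.mem_delta {K : Subgroup G} {x y : G} :
    (x, y) ∈ (MPair.delta A K).D ↔ x ∈ K ∧ x = y := by
  constructor
  · rintro ⟨k, hk, e⟩
    obtain ⟨rfl, rfl⟩ := Prod.mk.inj e
    exact ⟨hk, rfl⟩
  · rintro ⟨hk, rfl⟩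
    exact ⟨x, hk, rfl⟩

theorem MPair.compat_delta (p : MPair A (G × H)) (K : Subgroup H) :
    p.Compat (MPair.delta A K) := by
  intro h h₁ h₂
  obtain ⟨-, rfl⟩ := MPair.mem_delta.1 h₂
  change _ = 1
  rw [inv_eq_one]
  exact map_one p.φ

theorem MPair.delta_compat (K : Subgroup G) (p : MPair A (G × H)) :
    (MPair.delta A K).Compat p := by
  intro h h₁ h₂
  obtain ⟨-, rfl⟩ := MPair.mem_delta.1 h₁
  exact (map_one p.φ).symm ▸ inv_one

/-- The stabilizer in `G` of the `A`-orbit of `x`. -/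
def FibSet.stab {X : FibSet A G} (x : X) : Subgroup G where
  carrier := {g | ∃ a : A, g • x = a • x}
  one_mem' := ⟨1, by simp⟩
  mul_mem' := by
    rintro g h ⟨a, ha⟩ ⟨b, hb⟩
    exact ⟨a * b, by rw [mul_smul, hb, smul_comm, ha, smul_smul, mul_comm]⟩
  inv_mem' := by
    rintro g ⟨a, ha⟩
    exact ⟨a⁻¹, by rw [inv_smul_eq_iff, smul_comm, ha, smul_smul, inv_mul_cancel, one_smul]⟩

/-- The stabilizing pair `(G_x, φ_x)` of `x`, where `g x = φ_x(g) x` for `g ∈ G_x`. -/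
noncomputable def FibSet.stabPair {X : FibSet A G} (x : X) : MPair A G where
  D := FibSet.stab x
  φ := MonoidHom.mk' (fun g => g.2.choose) (by
    rintro ⟨g, hg⟩ ⟨h, hh⟩
    refine X.free _ _ x ?_
    have e : (g * h) • x = (hg.choose * hh.choose) • x := by
      have e1 : h • x = hh.choose • x := hh.choose_spec
      have e2 : g • x = hg.choose • x := hg.choose_spec
      generalize hg.choose = a at *
      generalize hh.choose = b at *
      rw [mul_smul, e1, smul_comm, e2, smul_smul, mul_comm]
    exact ((FibSet.stab x).mul_mem hg hh).choose_spec.symm.trans e)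

theorem FibSet.stabPair_smul {X : FibSet A G} (x : X) {g : G} (hg : g ∈ (FibSet.stabPair x).D) :
    g • x = (FibSet.stabPair x).φ ⟨g, hg⟩ • x := hg.choose_spec

theorem FibSet.stabPair_φ {X : FibSet A G} {x : X} {g : G} (hg : g ∈ (FibSet.stabPair x).D)
    {a : A} (h : g • x = a • x) : (FibSet.stabPair x).φ ⟨g, hg⟩ = a :=
  X.free _ _ x (by rw [← h, FibSet.stabPair_smul x hg])

theorem FibSet.stabPair_eq {X : FibSet A G} {x : X} {p : MPair A G}
    (h : ∀ g hg, g • x = p.φ ⟨g, hg⟩ • x) (h' : FibSet.stab x ≤ p.D) :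
    FibSet.stabPair x = p :=
  MPair.ext' (fun _ => ⟨fun hg => h' hg, fun hg => ⟨_, h _ hg⟩⟩)
    fun _ _ hq => FibSet.stabPair_φ _ (h _ hq)

theorem FibSet.compat_of_free {U : FibSet A (G × H)} {V : FibSet A (H × K)} {u : U} {v : V}
    (hf : (U.bmk V u v).Free) : (FibSet.stabPair u).Compat (FibSet.stabPair v) := by
  intro h h₁ h₂
  have e1 := FibSet.stabPair_smul u h₁
  have e2 := FibSet.stabPair_smul v h₂
  set a := (FibSet.stabPair u).φ ⟨_, h₁⟩
  set b := (FibSet.stabPair v).φ ⟨_, h₂⟩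
  have := FibSet.bmk_free.1 hf h b⁻¹ (b * a) (by rw [e1, smul_smul, inv_inv])
    (by rw [e2, smul_smul, inv_mul_cancel, one_smul])
  rw [inv_eq_iff_mul_eq_one, mul_comm, this]

theorem FibSet.free_of_compat {U : FibSet A (G × H)} {V : FibSet A (H × K)} {u : U} {v : V}
    (hc : (FibSet.stabPair u).Compat (FibSet.stabPair v)) : (U.bmk V u v).Free := by
  refine FibSet.bmk_free.2 fun h a c e1 e2 => ?_
  have e1' : ((1, h) : G × H) • u = (a * c) • u := by
    rw [mul_smul, e1, smul_inv_smul]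
  have e2' : ((h, 1) : H × K) • v = a⁻¹ • v := by
    rw [eq_inv_smul_iff]; exact e2.symm
  have := hc h ⟨_, e1'⟩ ⟨_, e2'⟩
  have this : (a * c)⁻¹ = a⁻¹ :=
    (congrArg _ (FibSet.stabPair_φ _ e1')).symm.trans (this.trans (FibSet.stabPair_φ _ e2'))
  simpa using this

/-- The stabilizing pair of `u ⊗ v` is the product of the stabilizing pairs. -/
theorem FibSet.stabPair_btmk {U : FibSet A (G × H)} {V : FibSet A (H × K)} {u : U} {v : V}
    (hf : (U.bmk V u v).Free) : FibSet.stabPair (FibSet.btmk u v hf) =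
      (FibSet.stabPair u).star (FibSet.stabPair v) (FibSet.compat_of_free hf) := by
  refine FibSet.stabPair_eq ?_ ?_
  · rintro ⟨g, k⟩ ⟨h, h₁, h₂⟩
    refine Eq.trans ?_ (congrArg (· • FibSet.btmk u v hf) (MPair.star_φ h₁ h₂ _)).symm
    have e1 := FibSet.stabPair_smul u h₁
    have e2 := FibSet.stabPair_smul v h₂
    refine Subtype.ext ?_
    refine FibSet.bmk_eq (u := ((g, 1) : G × H) • u) (v := ((1, k) : H × K) • v)
      (u' := ((FibSet.stabPair u).φ ⟨_, h₁⟩ * (FibSet.stabPair v).φ ⟨_, h₂⟩) • u) (v' := v) |>.2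
      ⟨h, ((FibSet.stabPair v).φ ⟨_, h₂⟩)⁻¹, ?_, ?_⟩
    · rw [inv_inv, smul_smul ((1, h) : G × H)]
      simp only [Prod.mk_mul_mk, one_mul, mul_one]
      rw [e1, smul_smul, mul_comm]
    · rw [smul_smul ((h, 1) : H × K)]
      simp only [Prod.mk_mul_mk, one_mul, mul_one]
      rw [e2, smul_smul, inv_mul_cancel, one_smul]
  · rintro ⟨g, k⟩ ⟨a, ha⟩
    obtain ⟨h, b, e1, e2⟩ := FibSet.bmk_eq (u := ((g, 1) : G × H) • u)
      (v := ((1, k) : H × K) • v) (u' := a • u) (v' := v) |>.1 (congrArg Subtype.val ha)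
    rw [smul_smul ((1, h) : G × H)] at e1
    rw [smul_smul ((h, 1) : H × K)] at e2
    simp only [Prod.mk_mul_mk, one_mul, mul_one] at e1 e2
    exact ⟨h, ⟨b * a, by rw [mul_smul, e1, smul_inv_smul]⟩,
      ⟨b⁻¹, by rw [eq_inv_smul_iff]; exact e2.symm⟩⟩

/-- The `A`-fibered `G`-set `G / (D, φ)`, i.e. `(G × A) / {(g, φ(g)⁻¹) | g ∈ D}`. -/
def FibSet.coset [Finite G] (p : MPair A G) : FibSet A G :=
  letI S : Subgroup (G × A) := (p.D.subtype.prod p.φ⁻¹).range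
  letI actG : MulAction G ((G × A) ⧸ S) := MulAction.compHom _ (MonoidHom.inl G A)
  letI actA : MulAction A ((G × A) ⧸ S) := MulAction.compHom _ (MonoidHom.inr G A)
  { carrier := (G × A) ⧸ S
    actG := actG
    actA := actA
    comm := ⟨fun g a x => by
      change (MonoidHom.inl G A g) • (MonoidHom.inr G A a) • x =
        (MonoidHom.inr G A a) • (MonoidHom.inl G A g) • x
      rw [smul_smul, smul_smul]
      simp⟩
    free := by
      rintro a b ⟨g, c⟩ h
      obtain ⟨d, hd⟩ := QuotientGroup.eq.1 h
      have e1 : d.1 = (1 * g)⁻¹ * (1 * g) := congrArg Prod.fst hd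
      have e2 : (p.φ d)⁻¹ = (a * c)⁻¹ * (b * c) := congrArg Prod.snd hd
      have : d = 1 := Subtype.ext (by simpa using e1)
      rw [this, map_one, inv_one] at e2
      have := inv_mul_eq_one.1 e2.symm
      exact mul_right_cancel this
    finite := by
      refine Finite.of_surjective (α := G)
        (fun g => Quotient.mk _ (QuotientGroup.mk (s := S) (g, (1 : A)))) ?_
      rintro ⟨⟨g, a⟩⟩
      refine ⟨g, Quotient.sound ⟨a⁻¹, ?_⟩⟩
      change QuotientGroup.mk (s := S) ((1, a⁻¹) * (g, a)) = _
      simp }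

def FibSet.cosetMk [Finite G] (p : MPair A G) (g : G) (a : A) : FibSet.coset p :=
  QuotientGroup.mk (s := (p.D.subtype.prod p.φ⁻¹).range) (g, a)

theorem FibSet.cosetMk_eq [Finite G] (p : MPair A G) (g g' : G) (a a' : A) :
    FibSet.cosetMk p g a = FibSet.cosetMk p g' a' ↔
      ∃ h : g⁻¹ * g' ∈ p.D, a = a' * p.φ ⟨_, h⟩ := by
  refine QuotientGroup.eq.trans ?_
  constructor
  · rintro ⟨⟨d, hd⟩, e⟩
    obtain ⟨rfl, e2⟩ := Prod.mk.inj e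
    refine ⟨hd, ?_⟩
    change (p.φ ⟨_, hd⟩)⁻¹ = a⁻¹ * a' at e2
    rw [← inv_inj, inv_inv] at e2
    change a = a' * p.φ ⟨_, hd⟩
    exact e2.symm ▸ by simp
  · rintro ⟨h, e⟩
    refine ⟨⟨_, h⟩, Prod.ext rfl ?_⟩
    change (p.φ ⟨_, h⟩)⁻¹ = a⁻¹ * a'
    rw [e]; simp

theorem FibSet.cosetMk_surj [Finite G] (p : MPair A G) (x : FibSet.coset p) :
    ∃ g a, FibSet.cosetMk p g a = x := by
  obtain ⟨⟨g, a⟩⟩ := x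
  exact ⟨g, a, rfl⟩

theorem FibSet.smul_cosetMk [Finite G] (p : MPair A G) (h g : G) (a : A) :
    h • FibSet.cosetMk p g a = FibSet.cosetMk p (h * g) a := by
  change QuotientGroup.mk (s := (p.D.subtype.prod p.φ⁻¹).range) ((h, 1) * (g, a)) = _
  rw [Prod.mk_mul_mk, one_mul]; rfl

theorem FibSet.smulA_cosetMk [Finite G] (p : MPair A G) (b : A) (g : G) (a : A) :
    b • FibSet.cosetMk p g a = FibSet.cosetMk p g (b * a) := by
  change QuotientGroup.mk (s := (p.D.subtype.prod p.φ⁻¹).range) ((1, b) * (g, a)) = _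
  rw [Prod.mk_mul_mk, one_mul]; rfl

theorem FibSet.stabPair_coset [Finite G] (p : MPair A G) :
    FibSet.stabPair (FibSet.cosetMk p 1 1) = p := by
  refine FibSet.stabPair_eq (fun g hg => ?_) ?_
  · rw [FibSet.smul_cosetMk, FibSet.smulA_cosetMk, FibSet.cosetMk_eq]
    refine ⟨by simpa using hg, ?_⟩
    rw [mul_one, ← map_mul]
    exact ((congrArg p.φ (Subtype.ext (by simp))).trans (map_one p.φ)).symm
  · rintro g ⟨a, h⟩
    rw [FibSet.smul_cosetMk, FibSet.smulA_cosetMk, FibSet.cosetMk_eq] at h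
    obtain ⟨h, -⟩ := h
    simpa using h

/-- A transitive fibered set is determined by the stabilizing pair of any of its points. -/
theorem FibSet.isom_coset [Finite G] {X : FibSet A G} (x : X)
    (ht : ∀ y : X, ∃ (g : G) (a : A), y = a • g • x) :
    FibSet.Isom X (FibSet.coset (FibSet.stabPair x)) := by
  refine .of_param (T := G × A) (fun t => t.2 • t.1 • x)
    (fun t => FibSet.cosetMk _ t.1 t.2) ?_ ?_ ?_ ?_ ?_
  · intro y
    obtain ⟨g, a, rfl⟩ := ht y
    exact ⟨(g, a), rfl⟩
  · intro y
    obtain ⟨g, a, rfl⟩ := FibSet.cosetMk_surj _ y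
    exact ⟨(g, a), rfl⟩
  · rintro ⟨g, a⟩ ⟨g', a'⟩
    rw [FibSet.cosetMk_eq]
    dsimp only
    have : a • g • x = a' • g' • x ↔ (g⁻¹ * g') • x = (a'⁻¹ * a) • x := by
      rw [mul_smul, mul_smul, inv_smul_eq_iff, eq_comm, smul_comm g a'⁻¹, eq_inv_smul_iff,
        smul_comm g a]
    rw [this]
    constructor
    · intro h
      refine ⟨⟨_, h⟩, ?_⟩
      refine Eq.trans ?_ (congrArg (a' * ·) (FibSet.stabPair_φ _ h)).symm
      simp
    · rintro ⟨h, e⟩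
      rw [FibSet.stabPair_smul x h, e]
      simp
  · rintro h ⟨g, a⟩
    refine ⟨(h * g, a), ?_, (FibSet.smul_cosetMk _ _ _ _).symm⟩
    rw [mul_smul, smul_comm h a]
  · rintro h ⟨g, a⟩
    exact ⟨(g, h * a), mul_smul _ _ _, (FibSet.smulA_cosetMk _ _ _ _).symm⟩

theorem FibSet.tens_isom_coset [Finite G] [Finite K] {U : FibSet A (G × H)} {V : FibSet A (H × K)}
    (u : U) (v : V) {p : MPair A (G × H)} {q : MPair A (H × K)} (hp : FibSet.stabPair u = p)
    (hq : FibSet.stabPair v = q) (hU : ∀ y : U, ∃ (g : G × H) (a : A), y = a • g • u)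
    (hV : ∀ y : V, ∃ (g : H × K) (a : A), y = a • g • v) (hc : p.Compat q)
    (hd : ∀ h : H, ∃ h₁ h₂ g k, h = h₁ * h₂ ∧ (g, h₁) ∈ p.D ∧ (h₂, k) ∈ q.D) :
    FibSet.Isom (U.bisetTens V) (FibSet.coset (p.star q hc)) := by
  subst hp hq
  have hf := FibSet.free_of_compat hc
  rw [← FibSet.stabPair_btmk hf]
  refine FibSet.isom_coset _ fun y => ?_
  obtain ⟨u', v', hf', rfl⟩ := FibSet.btmk_surj y
  obtain ⟨⟨g, h⟩, a, rfl⟩ := hU u'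
  obtain ⟨⟨h', k⟩, b, rfl⟩ := hV v'
  obtain ⟨h₁, h₂, g₁, k₂, e, m₁, m₂⟩ := hd (h⁻¹ * h')
  have e1 := FibSet.stabPair_smul u m₁
  have e2 := FibSet.stabPair_smul v m₂
  generalize (FibSet.stabPair u).φ ⟨_, m₁⟩ = c at e1
  generalize (FibSet.stabPair v).φ ⟨_, m₂⟩ = d at e2
  refine ⟨(g * g₁, k * k₂⁻¹), a * b * d * c⁻¹, Subtype.ext (FibSet.bmk_eq
    (u := (a * b * d * c⁻¹) • ((g * g₁, 1) : G × H) • u)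
    (v := ((1, k * k₂⁻¹) : H × K) • v) |>.2 ⟨h * h₁, b * d, ?_, ?_⟩).symm⟩
  · have : ((1, h * h₁) : G × H) * (g * g₁, 1) = (g, h) * (g₁, h₁) := by simp
    rw [smul_comm _ (a * b * d * c⁻¹), smul_smul ((1, h * h₁) : G × H), this,
      mul_smul (g, h), e1, smul_comm _ c, smul_smul, smul_smul]
    congr 1
    rw [mul_assoc a b d, mul_comm a (b * d)]
    group
  · have : ((h * h₁, 1) : H × K) * (1, k * k₂⁻¹) = (h', k) * (h₂, k₂)⁻¹ := by
      rw [eq_mul_inv_of_mul_eq e.symm]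
      simp [mul_assoc]
    have e3 : ((h₂, k₂) : H × K)⁻¹ • v = d⁻¹ • v := by
      rw [inv_smul_eq_iff, smul_comm, e2, inv_smul_smul]
    rw [smul_smul ((h * h₁, 1) : H × K), this, mul_smul (h', k), e3, smul_comm _ d⁻¹,
      mul_smul b, smul_inv_smul]

/-- The Mackey formula when there is only one double coset and the pairs are composable. -/
theorem FibSet.coset_tens [Finite G] [Finite H] [Finite K] (p : MPair A (G × H))
    (q : MPair A (H × K)) (hc : p.Compat q)
    (hd : ∀ h : H, ∃ h₁ h₂ g k, h = h₁ * h₂ ∧ (g, h₁) ∈ p.D ∧ (h₂, k) ∈ q.D) :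
    FibSet.Isom ((FibSet.coset p).bisetTens (FibSet.coset q)) (FibSet.coset (p.star q hc)) := by
  refine FibSet.tens_isom_coset _ _ (FibSet.stabPair_coset p) (FibSet.stabPair_coset q)
    (fun y => ?_) (fun y => ?_) hc hd
  · obtain ⟨g, a, rfl⟩ := FibSet.cosetMk_surj _ y
    exact ⟨g, a, by rw [FibSet.smul_cosetMk, FibSet.smulA_cosetMk, mul_one, mul_one]⟩
  · obtain ⟨g, a, rfl⟩ := FibSet.cosetMk_surj _ y
    exact ⟨g, a, by rw [FibSet.smul_cosetMk, FibSet.smulA_cosetMk, mul_one, mul_one]⟩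

end Pairs

/-! ### The Grothendieck group of fibered sets -/

section Burnside

variable {A G H K L : Type u} [CommGroup A] [Group G] [Group H] [Group K] [Group L]

instance isoSetoid (A G : Type u) [CommGroup A] [Group G] : Setoid (FibSet A G) :=
  ⟨FibSet.Isom, FibSet.Isom.refl, FibSet.Isom.symm, FibSet.Isom.trans⟩

/-- Isomorphism classes of `A`-fibered `G`-sets. -/
def IsoCl (A G : Type u) [CommGroup A] [Group G] : Type (u + 1) := Quotient (isoSetoid A G)

def IsoCl.mk (X : FibSet A G) : IsoCl A G := Quotient.mk _ X

theorem IsoCl.sound {X Y : FibSet A G} (h : FibSet.Isom X Y) : IsoCl.mk X = IsoCl.mk Y :=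
  Quotient.sound h

instance : Add (IsoCl A G) :=
  ⟨Quotient.map₂ FibSet.sum fun _ _ h _ _ h' => FibSet.sum_isom h h'⟩

instance : Zero (IsoCl A G) := ⟨IsoCl.mk (FibSet.empty A G)⟩

/-- Isomorphism classes form a commutative monoid under disjoint union. -/
instance : AddCommMonoid (IsoCl A G) where
  nsmul := nsmulRec
  add_assoc := by
    rintro ⟨X⟩ ⟨Y⟩ ⟨Z⟩
    refine Quotient.sound ⟨⟨Equiv.sumAssoc X Y Z, ?_, ?_⟩, (Equiv.sumAssoc X Y Z).bijective⟩
    · rintro g ((x | x) | x) <;> rfl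
    · rintro g ((x | x) | x) <;> rfl
  zero_add := by
    rintro ⟨X⟩
    refine Quotient.sound ⟨⟨Equiv.emptySum PEmpty X, ?_, ?_⟩, (Equiv.emptySum PEmpty X).bijective⟩
    · rintro g (x | x)
      · exact x.elim
      · rfl
    · rintro g (x | x)
      · exact x.elim
      · rfl
  add_zero := by
    rintro ⟨X⟩
    refine Quotient.sound ⟨⟨Equiv.sumEmpty X PEmpty, ?_, ?_⟩, (Equiv.sumEmpty X PEmpty).bijective⟩
    · rintro g (x | x)
      · rfl
      · exact x.elim
    · rintro g (x | x)
      · rfl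
      · exact x.elim
  add_comm := by
    rintro ⟨X⟩ ⟨Y⟩
    refine Quotient.sound ⟨⟨Equiv.sumComm X Y, ?_, ?_⟩, (Equiv.sumComm X Y).bijective⟩
    · rintro g (x | x) <;> rfl
    · rintro g (x | x) <;> rfl

theorem IsoCl.mk_sum (X Y : FibSet A G) : IsoCl.mk (X.sum Y) = IsoCl.mk X + IsoCl.mk Y := rfl

/-- The Grothendieck group `B^A(G)` of `A`-fibered `G`-sets. -/
abbrev Burnside (A G : Type u) [CommGroup A] [Group G] : Type (u + 1) :=
  Algebra.GrothendieckAddGroup (IsoCl A G)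

/-- The class `[X]` in `B^A(G)`. -/
def cls (X : FibSet A G) : Burnside A G := Algebra.GrothendieckAddGroup.of (IsoCl.mk X)

theorem cls_eq {X Y : FibSet A G} (h : FibSet.Isom X Y) : cls X = cls Y :=
  congrArg (fun t => Algebra.GrothendieckAddGroup.of t) (IsoCl.sound h)

theorem cls_sum (X Y : FibSet A G) : cls (X.sum Y) = cls X + cls Y :=
  (congrArg _ (IsoCl.mk_sum X Y)).trans (map_add _ _ _)

theorem cls_empty : cls (FibSet.empty A G) = 0 :=
  map_zero (Algebra.GrothendieckAddGroup.of (M := IsoCl A G))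

theorem Burnside.induction {p : Burnside A G → Prop} (h : ∀ X, p (cls X))
    (hadd : ∀ x y, p x → p y → p (x + y)) (hneg : ∀ x, p x → p (-x)) (x : Burnside A G) : p x := by
  induction x using AddLocalization.ind with
  | _ y =>
    obtain ⟨⟨X⟩, ⟨Y⟩, hY⟩ := y
    have : AddLocalization.mk (IsoCl.mk X) ⟨IsoCl.mk Y, hY⟩ = cls X + -cls Y := by
      rw [AddLocalization.mk_eq_addMonoidOf_mk', AddSubmonoid.LocalizationMap.mk'_eq_iff_eq_add]
      change cls X = cls X + -cls Y + cls Y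
      abel
    exact this ▸ hadd _ _ (h X) (hneg _ (h Y))

/-- The tensor product on isomorphism classes. -/
def isoTens : IsoCl A (G × H) →+ IsoCl A (H × K) →+ IsoCl A (G × K) where
  toFun x :=
    { toFun := fun y => Quotient.map₂ FibSet.bisetTens
        (fun _ _ h _ _ h' => FibSet.bisetTens_isom h h') x y
      map_zero' := by
        obtain ⟨X⟩ := x
        exact IsoCl.sound (FibSet.bisetTens_empty_right X)
      map_add' := by
        obtain ⟨X⟩ := x
        rintro ⟨Y⟩ ⟨Z⟩
        exact IsoCl.sound (FibSet.bisetTens_sum_right X Y Z) }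
  map_zero' := by
    ext y
    obtain ⟨Y⟩ := y
    exact IsoCl.sound (FibSet.bisetTens_empty_left Y)
  map_add' := by
    intro x x'
    ext y
    obtain ⟨X⟩ := x
    obtain ⟨X'⟩ := x'
    obtain ⟨Y⟩ := y
    exact IsoCl.sound (FibSet.bisetTens_sum_left X X' Y)

theorem lift_of {M N : Type*} [AddCommMonoid M] [AddCommGroup N] (f : M →+ N) (m : M) :
    Algebra.GrothendieckAddGroup.lift f (Algebra.GrothendieckAddGroup.of m) = f m :=
  DFunLike.congr_fun (Algebra.GrothendieckAddGroup.lift.symm_apply_apply f) m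

/-- The tensor product `B^A(G, H) × B^A(H, K) → B^A(G, K)`. -/
noncomputable def burnsideTens :
    Burnside A (G × H) →+ Burnside A (H × K) →+ Burnside A (G × K) :=
  Algebra.GrothendieckAddGroup.lift
    { toFun := fun x => Algebra.GrothendieckAddGroup.lift
        ((Algebra.GrothendieckAddGroup.of (M := IsoCl A (G × K))).comp (isoTens x))
      map_zero' := by
        apply Algebra.GrothendieckAddGroup.lift.symm.injective
        ext y
        simp
      map_add' := fun x x' => by
        apply Algebra.GrothendieckAddGroup.lift.symm.injective
        refine AddMonoidHom.ext fun y => ?_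
        have h := lift_of ((Algebra.GrothendieckAddGroup.of (M := IsoCl A (G × K))).comp
          (isoTens x)) y
        have h' := lift_of ((Algebra.GrothendieckAddGroup.of (M := IsoCl A (G × K))).comp
          (isoTens x')) y
        rw [Equiv.symm_apply_apply]
        refine Eq.trans ?_ (congrArg₂ (· + ·) h h').symm
        simp }

theorem burnsideTens_cls (U : FibSet A (G × H)) (V : FibSet A (H × K)) :
    burnsideTens (cls U) (cls V) = cls (U.bisetTens V) := by
  unfold burnsideTens cls
  rw [lift_of]
  exact lift_of (Algebra.GrothendieckAddGroup.of.comp (isoTens (IsoCl.mk U))) (IsoCl.mk V)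

theorem burnsideTens_assoc (x : Burnside A (G × H)) (y : Burnside A (H × K))
    (z : Burnside A (K × L)) :
    burnsideTens (burnsideTens x y) z = burnsideTens x (burnsideTens y z) := by
  induction x using Burnside.induction with
  | hadd x x' h h' => simp [h, h']
  | hneg x h => simp [h]
  | h X =>
    induction y using Burnside.induction with
    | hadd x x' h h' => simp [h, h']
    | hneg x h => simp [h]
    | h Y =>
      induction z using Burnside.induction with
      | hadd x x' h h' => simp [h, h']
      | hneg x h => simp [h]
      | h Z =>
        rw [burnsideTens_cls, burnsideTens_cls, burnsideTens_cls, burnsideTens_cls]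
        exact cls_eq (FibSet.bisetTens_assoc X Y Z)

/-- The class of a fibered set lies in any subgroup containing the classes of its orbits. -/
theorem cls_mem [Finite G] (S : AddSubgroup (Burnside A G)) (X : FibSet A G)
    (h : ∀ x : X, cls (FibSet.coset (FibSet.stabPair x)) ∈ S) : cls X ∈ S := by
  generalize hn : Nat.card (MulAction.orbitRel.Quotient A X) = n
  induction n using Nat.strong_induction_on generalizing X with
  | _ n ih =>
    by_cases he : IsEmpty X
    · rw [cls_eq (FibSet.isom_of_isEmpty X (FibSet.empty A G)), cls_empty]
      exact S.zero_mem
    · obtain ⟨x⟩ := not_isEmpty_iff.1 he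
      let p : X → Prop := fun y => ∃ (g : G) (a : A), y = a • g • x
      have pG : ∀ (g : G) y, p y → p (g • y) := by
        rintro g _ ⟨k, a, rfl⟩
        exact ⟨g * k, a, by rw [smul_comm, mul_smul]⟩
      have pA : ∀ (a : A) y, p y → p (a • y) := by
        rintro b _ ⟨k, a, rfl⟩
        exact ⟨k, b * a, by rw [mul_smul]⟩
      have nG : ∀ (g : G) y, ¬ p y → ¬ p (g • y) := fun g y h h' =>
        h (by simpa using pG g⁻¹ _ h')
      have nA : ∀ (g : A) y, ¬ p y → ¬ p (g • y) := fun g y h h' =>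
        h (by simpa using pA g⁻¹ _ h')
      let X₁ := X.restrict p pG pA
      let X₂ := X.restrict (fun y => ¬ p y) nG nA
      have hX : FibSet.Isom (X₁.sum X₂) X := by
        refine ⟨⟨Sum.elim Subtype.val Subtype.val, ?_, ?_⟩, ?_, ?_⟩
        · rintro g (y | y) <;> rfl
        · rintro g (y | y) <;> rfl
        · rintro (y | y) (z | z) e
          · exact congrArg Sum.inl (Subtype.ext e)
          · have e : y.1 = z.1 := e
            exact (z.2 (e ▸ y.2)).elim
          · have e : y.1 = z.1 := e
            exact (y.2 (e ▸ z.2)).elim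
          · exact congrArg Sum.inr (Subtype.ext e)
        · intro y
          by_cases hy : p y
          · exact ⟨Sum.inl ⟨y, hy⟩, rfl⟩
          · exact ⟨Sum.inr ⟨y, hy⟩, rfl⟩
      have hs₁ : ∀ y : X₁, FibSet.stabPair y = FibSet.stabPair (X := X) y.1 := fun y =>
        FibSet.stabPair_eq (fun g hg => Subtype.ext (FibSet.stabPair_smul (X := X) y.1 hg))
          (fun g hg => hg.imp fun a ha => congrArg Subtype.val ha)
      have hs₂ : ∀ y : X₂, FibSet.stabPair y = FibSet.stabPair (X := X) y.1 := fun y =>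
        FibSet.stabPair_eq (fun g hg => Subtype.ext (FibSet.stabPair_smul (X := X) y.1 hg))
          (fun g hg => hg.imp fun a ha => congrArg Subtype.val ha)
      rw [← cls_eq hX, cls_sum]
      refine S.add_mem ?_ ?_
      · let x₁ : X₁ := ⟨x, 1, 1, by simp⟩
        rw [cls_eq (FibSet.isom_coset x₁ ?_), hs₁]
        · exact h _
        · rintro ⟨y, g, a, rfl⟩
          exact ⟨g, a, rfl⟩
      · refine ih _ ?_ X₂ (fun y => hs₂ y ▸ h _) rfl
        rw [← hn]
        let f : MulAction.orbitRel.Quotient A X₂ → MulAction.orbitRel.Quotient A X :=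
          Quotient.lift (fun y => Quotient.mk _ y.1) (by
            rintro y z ⟨a, rfl⟩
            exact Quotient.sound ⟨a, rfl⟩)
        have hf : Function.Injective f := by
          rintro ⟨y⟩ ⟨z⟩ e
          obtain ⟨a, ha⟩ := Quotient.exact e
          exact Quotient.sound ⟨a, Subtype.ext ha⟩
        by_contra hle
        obtain ⟨⟨y⟩, e⟩ := (hf.bijective_of_nat_card_le (not_lt.1 hle)).2 (Quotient.mk _ x)
        obtain ⟨a, ha⟩ := Quotient.exact e
        have ha : a • x = y.1 := ha
        exact y.2 ⟨1, a, by rw [one_smul, ha]⟩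

end Burnside

/-! ### Extension of scalars -/

section Scalars

variable (R : Type v) [CommRing R] {A G H K L : Type u} [CommGroup A] [Group G] [Group H]
  [Group K] [Group L]

/-- `B^A_R(G) = R ⊗_ℤ B^A(G)`. -/
abbrev BurnsideR (A G : Type u) [CommGroup A] [Group G] : Type (max v (u + 1)) :=
  R ⊗[ℤ] Burnside A G

/-- The class `[X] = 1 ⊗ [X]` in `B^A_R(G)`. -/
noncomputable def clsR (X : FibSet A G) : BurnsideR R A G := 1 ⊗ₜ cls X

/-- The `R`-bilinear extension of the tensor product. -/
noncomputable def tensR :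
    BurnsideR R A (G × H) →ₗ[R] BurnsideR R A (H × K) →ₗ[R] BurnsideR R A (G × K) :=
  TensorProduct.AlgebraTensorModule.lift (LinearMap.toSpanSingleton R _
    (AddMonoidHom.toIntLinearMap
      { toFun := fun x => LinearMap.baseChange R (burnsideTens x).toIntLinearMap
        map_zero' := by ext; simp
        map_add' := fun x y => by ext; simp [TensorProduct.tmul_add] }))

theorem tensR_tmul (r s : R) (x : Burnside A (G × H)) (y : Burnside A (H × K)) :
    tensR R (r ⊗ₜ x) (s ⊗ₜ y) = (r * s) ⊗ₜ burnsideTens x y := by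
  simp [tensR, TensorProduct.smul_tmul']

theorem tensR_cls (U : FibSet A (G × H)) (V : FibSet A (H × K)) :
    tensR R (clsR R U) (clsR R V) = clsR R (U.bisetTens V) := by
  rw [clsR, clsR, tensR_tmul, mul_one, burnsideTens_cls, clsR]

theorem tensR_assoc (x : BurnsideR R A (G × H)) (y : BurnsideR R A (H × K))
    (z : BurnsideR R A (K × L)) :
    tensR R (tensR R x y) z = tensR R x (tensR R y z) := by
  induction x using TensorProduct.induction_on with
  | zero => simp
  | add x x' h h' => simp [h, h']
  | tmul r x =>
    induction y using TensorProduct.induction_on with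
    | zero => simp
    | add x x' h h' => simp [h, h']
    | tmul s y =>
      induction z using TensorProduct.induction_on with
      | zero => simp
      | add x x' h h' => simp [h, h']
      | tmul t z =>
        rw [tensR_tmul, tensR_tmul, tensR_tmul, tensR_tmul, mul_assoc, burnsideTens_assoc]

end Scalars

/-! ### The data `(𝒢, 𝒮)` and the category `𝒟 = 𝒞^A(𝒢, 𝒮)` -/

/-- A group, given as a subgroup of an ambient group. As in set theory, a subgroup of a group, or of
a subgroup of it, is then again an object of the same kind (with the same ambient group), and
no identification of different copies of the same subgroup is needed. An arbitrary group `Γ` is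
the case `⟨Γ, ⊤⟩`. -/
structure CGroup : Type (u + 1) where
  amb : Type u
  [grp : Group amb]
  carrier : Subgroup amb

attribute [instance] CGroup.grp

instance : CoeSort CGroup.{u} (Type u) := ⟨fun G => G.carrier⟩

/-- A subgroup `P` of `G`, as a group. -/
abbrev CGroup.sub (G : CGroup.{u}) (P : Subgroup G.amb) : CGroup.{u} := ⟨G.amb, P⟩

/-- The inclusion of `G × H` in the product of the ambient groups. -/
def CGroup.incl (G H : CGroup.{u}) : G × H →* G.amb × H.amb :=
  G.carrier.subtype.prodMap H.carrier.subtype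

theorem CGroup.incl_injective (G H : CGroup.{u}) : Function.Injective (CGroup.incl G H) :=
  Prod.map_injective.2 ⟨Subtype.val_injective, Subtype.val_injective⟩

/-- The data `(𝒢, 𝒮)`: a class `𝒢` of finite groups and subsets `𝒮(G, H) ⊆ ℳ(G × H)` for
`G, H ∈ 𝒢`, satisfying four axioms. -/
structure GroupSystem (A : Type u) [CommGroup A] where
  𝒢 : Set CGroup.{u}
  finite : ∀ G ∈ 𝒢, Finite G
  S : ∀ G H : CGroup.{u}, Set (MPair A (G.amb × H.amb))
  S_le : ∀ G ∈ 𝒢, ∀ H ∈ 𝒢, ∀ p ∈ S G H, p.D ≤ G.carrier.prod H.carrier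
  /-- `(Δ(G), 1) ∈ 𝒮(G, G)` -/
  delta_mem : ∀ G ∈ 𝒢, MPair.delta A G.carrier ∈ S G G
  /-- closure under conjugation -/
  conj_mem : ∀ G ∈ 𝒢, ∀ H ∈ 𝒢, ∀ p ∈ S G H, ∀ g ∈ G.carrier, ∀ h ∈ H.carrier,
    p.conj (g, h) ∈ S G H
  /-- closure under products of composable pairs -/
  star_mem : ∀ G ∈ 𝒢, ∀ H ∈ 𝒢, ∀ K ∈ 𝒢, ∀ p ∈ S G H, ∀ q ∈ S H K, ∀ hc : p.Compat q,
    p.star q hc ∈ S G K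
  /-- for `(D, φ) ∈ 𝒮(G, H)` and `K ≤ H` with `K ∈ 𝒢`, one has `D ∗ K ∈ 𝒢` -/
  starSet_mem : ∀ G ∈ 𝒢, ∀ H ∈ 𝒢, ∀ p ∈ S G H, ∀ K ≤ H.carrier, H.sub K ∈ 𝒢 →
    G.sub (starSet p.D K) ∈ 𝒢
  /-- for `(D, φ) ∈ 𝒮(G, H)` and `K ≤ H` with `K ∈ 𝒢`, one has
  `(D, φ) ∗ (Δ(K), 1) ∈ 𝒮(D ∗ K, K)` -/
  star_delta_mem : ∀ G ∈ 𝒢, ∀ H ∈ 𝒢, ∀ p ∈ S G H, ∀ K ≤ H.carrier, H.sub K ∈ 𝒢 →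
    p.star (MPair.delta A K) (p.compat_delta K) ∈ S (G.sub (starSet p.D K)) (H.sub K)

section Category

variable {A : Type u} [CommGroup A]

/-- A pair in `ℳ(G × H)`, with `G × H` a group in its own right, as a pair in the ambient group. -/
noncomputable def MPair.toAmb {G H : CGroup.{u}} (p : MPair A (G × H)) :
    MPair A (G.amb × H.amb) :=
  p.map (CGroup.incl G H) (CGroup.incl_injective G H)

/-- A pair with `D ≤ G × H` as a pair in `ℳ(G × H)`. -/
def MPair.ofAmb (G H : CGroup.{u}) (p : MPair A (G.amb × H.amb)) : MPair A (G × H) :=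
  p.comap (CGroup.incl G H)

theorem MPair.mem_toAmb {G H : CGroup.{u}} {p : MPair A (G × H)} {g : G} {h : H} :
    ((g : G.amb), (h : H.amb)) ∈ p.toAmb.D ↔ (g, h) ∈ p.D :=
  Subgroup.mem_map_iff_mem (CGroup.incl_injective G H) (x := (g, h))

theorem MPair.exists_of_mem_toAmb {G H : CGroup.{u}} {p : MPair A (G × H)} {x : G.amb} {y : H.amb}
    (h : (x, y) ∈ p.toAmb.D) : ∃ (g : G) (k : H), (g, k) ∈ p.D ∧ x = g ∧ y = k := by
  obtain ⟨⟨g, k⟩, hm, e⟩ := h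
  obtain ⟨rfl, rfl⟩ := Prod.mk.inj e
  exact ⟨g, k, hm, rfl, rfl⟩

theorem MPair.toAmb_φ {G H : CGroup.{u}} {p : MPair A (G × H)} {g : G} {h : H}
    (hm : (g, h) ∈ p.D) (hm' : ((g : G.amb), (h : H.amb)) ∈ p.toAmb.D) :
    p.toAmb.φ ⟨_, hm'⟩ = p.φ ⟨_, hm⟩ :=
  MPair.map_φ (CGroup.incl G H) _ p (g, h) hm hm'

theorem MPair.toAmb_le {G H : CGroup.{u}} (p : MPair A (G × H)) :
    p.toAmb.D ≤ G.carrier.prod H.carrier := by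
  rintro ⟨x, y⟩ h
  obtain ⟨g, k, -, rfl, rfl⟩ := MPair.exists_of_mem_toAmb h
  exact ⟨g.2, k.2⟩

theorem MPair.ofAmb_toAmb {G H : CGroup.{u}} (p : MPair A (G × H)) :
    MPair.ofAmb G H p.toAmb = p :=
  MPair.ext' (fun x => MPair.mem_toAmb (g := x.1) (h := x.2))
    fun x h h' => MPair.toAmb_φ (g := x.1) (h := x.2) h' h

theorem MPair.toAmb_ofAmb {G H : CGroup.{u}} {p : MPair A (G.amb × H.amb)}
    (hp : p.D ≤ G.carrier.prod H.carrier) : (MPair.ofAmb G H p).toAmb = p := by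
  refine MPair.ext' (fun x => ⟨fun h => ?_, fun h => ?_⟩) (fun x h h' => ?_)
  · obtain ⟨g, k, hm, h1, h2⟩ := MPair.exists_of_mem_toAmb (x := x.1) (y := x.2) h
    have : x = (g.1, k.1) := Prod.ext h1 h2
    exact this ▸ hm
  · exact (MPair.mem_toAmb (g := ⟨x.1, (hp h).1⟩) (h := ⟨x.2, (hp h).2⟩)).2 h
  · exact MPair.toAmb_φ (p := MPair.ofAmb G H p) (g := ⟨x.1, (hp h').1⟩) (h := ⟨x.2, (hp h').2⟩)
      h' h

theorem MPair.toAmb_compat {G H K : CGroup.{u}} {p : MPair A (G × H)} {q : MPair A (H × K)} :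
    p.toAmb.Compat q.toAmb ↔ p.Compat q := by
  constructor
  · intro hc h h₁ h₂
    have := hc h (MPair.mem_toAmb.2 h₁) (MPair.mem_toAmb.2 h₂)
    rw [← MPair.toAmb_φ h₁ (MPair.mem_toAmb.2 h₁), ← MPair.toAmb_φ h₂ (MPair.mem_toAmb.2 h₂)]
    exact this
  · intro hc h h₁ h₂
    have hh := (MPair.toAmb_le _ h₁).2
    have h₁' : ((1 : G), (⟨h, hh⟩ : H)) ∈ p.D := MPair.mem_toAmb.1 h₁
    have h₂' : ((⟨h, hh⟩ : H), (1 : K)) ∈ q.D := MPair.mem_toAmb.1 h₂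
    have e := hc ⟨h, hh⟩ h₁' h₂'
    rw [← MPair.toAmb_φ h₁' h₁, ← MPair.toAmb_φ h₂' h₂] at e
    exact e

theorem MPair.toAmb_star {G H K : CGroup.{u}} {p : MPair A (G × H)} {q : MPair A (H × K)}
    (hc : p.Compat q) :
    (p.star q hc).toAmb = p.toAmb.star q.toAmb (MPair.toAmb_compat.2 hc) := by
  have key : ∀ x, x ∈ (p.star q hc).toAmb.D →
      ∃ g h k, x = (g.1, k.1) ∧ (g, h) ∈ p.D ∧ (h, k) ∈ q.D := by
    rintro ⟨x, y⟩ hx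
    obtain ⟨g, k, ⟨h, h₁, h₂⟩, rfl, rfl⟩ := MPair.exists_of_mem_toAmb hx
    exact ⟨g, h, k, rfl, h₁, h₂⟩
  refine MPair.ext' (fun x => ⟨fun hx => ?_, ?_⟩) (fun x hx hx' => ?_)
  · obtain ⟨g, h, k, rfl, h₁, h₂⟩ := key x hx
    exact ⟨h, MPair.mem_toAmb.2 h₁, MPair.mem_toAmb.2 h₂⟩
  · obtain ⟨x, y⟩ := x
    rintro ⟨h, h₁, h₂⟩
    obtain ⟨g, h, m₁, rfl, rfl⟩ := MPair.exists_of_mem_toAmb h₁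
    obtain ⟨h', k, m₂, e, rfl⟩ := MPair.exists_of_mem_toAmb h₂
    obtain rfl := Subtype.ext e
    exact MPair.mem_toAmb.2 ⟨h, m₁, m₂⟩
  · obtain ⟨g, h, k, rfl, h₁, h₂⟩ := key x hx
    have a := MPair.toAmb_φ (p := p.star q hc) (g := g) (h := k) ⟨h, h₁, h₂⟩ hx
    have b := MPair.star_φ (hc := MPair.toAmb_compat.2 hc) (MPair.mem_toAmb.2 h₁)
      (MPair.mem_toAmb.2 h₂) hx'
    have c := MPair.star_φ (hc := hc) h₁ h₂ ⟨h, h₁, h₂⟩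
    rw [MPair.toAmb_φ h₁, MPair.toAmb_φ h₂] at b
    exact a.trans (c.trans b.symm)

theorem MPair.conj_φ {G : Type u} [Group G] (p : MPair A G) (g x : G) (h : x ∈ p.D)
    (h' : g * x * g⁻¹ ∈ (p.conj g).D) : (p.conj g).φ ⟨_, h'⟩ = p.φ ⟨x, h⟩ :=
  MPair.map_φ (MulAut.conj g).toMonoidHom _ p x h h'

theorem MPair.mem_conj {G : Type u} [Group G] {p : MPair A G} {g x : G} :
    x ∈ (p.conj g).D ↔ g⁻¹ * x * g ∈ p.D := by
  constructor
  · rintro ⟨y, hy, rfl⟩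
    simpa [mul_assoc] using hy
  · intro h
    exact ⟨_, h, by simp [mul_assoc]⟩

theorem MPair.conj_φ' {G : Type u} [Group G] (p : MPair A G) (g x : G)
    (h : x ∈ (p.conj g).D) : (p.conj g).φ ⟨x, h⟩ = p.φ ⟨g⁻¹ * x * g, MPair.mem_conj.1 h⟩ := by
  have e : g * (g⁻¹ * x * g) * g⁻¹ = x := by group
  have h' : g * (g⁻¹ * x * g) * g⁻¹ ∈ (p.conj g).D := e.symm ▸ h
  refine Eq.trans (congrArg _ (Subtype.ext e.symm)) (MPair.conj_φ p g _ (MPair.mem_conj.1 h) h')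

theorem MPair.toAmb_conj {G H : CGroup.{u}} (p : MPair A (G × H)) (g : G) (h : H) :
    (p.conj (g, h)).toAmb = p.toAmb.conj ((g : G.amb), (h : H.amb)) := by
  refine MPair.ext' (fun x => ⟨fun hx => ?_, fun hx => ?_⟩) (fun x hx hx' => ?_)
  · obtain ⟨x, y⟩ := x
    obtain ⟨x, y, hm, rfl, rfl⟩ := MPair.exists_of_mem_toAmb hx
    exact MPair.mem_conj.2 (MPair.mem_toAmb.2 (MPair.mem_conj.1 hm))
  · obtain ⟨x, y⟩ := x
    obtain ⟨x', y', hm, e, e'⟩ := MPair.exists_of_mem_toAmb (MPair.mem_conj.1 hx)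
    have e1 : x = (g * x' * g⁻¹ : G) := by
      push_cast
      rw [← e]
      simp [mul_assoc]
    have e2 : y = (h * y' * h⁻¹ : H) := by
      push_cast
      rw [← e']
      simp [mul_assoc]
    subst e1 e2
    refine MPair.mem_toAmb.2 (MPair.mem_conj.2 ?_)
    simpa [mul_assoc] using hm
  · obtain ⟨x, y⟩ := x
    obtain ⟨x, y, hm, rfl, rfl⟩ := MPair.exists_of_mem_toAmb hx
    refine (MPair.toAmb_φ hm hx).trans ((MPair.conj_φ' _ _ _ hm).trans ?_)
    refine Eq.trans ?_ (MPair.conj_φ' _ _ _ hx').symm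
    exact (MPair.toAmb_φ (MPair.mem_conj.1 hm) _).symm

theorem FibSet.stabPair_smul_eq {G : Type u} [Group G] {X : FibSet A G} (x : X) (g : G) :
    FibSet.stabPair (g • x) = (FibSet.stabPair x).conj g := by
  refine FibSet.stabPair_eq (fun y hy => ?_) ?_
  · have e := FibSet.stabPair_smul x (MPair.mem_conj.1 hy)
    rw [MPair.conj_φ']
    generalize (FibSet.stabPair x).φ _ = c at e ⊢
    rw [smul_comm c g x, ← e, smul_smul, smul_smul]
    congr 1
    group
  · rintro y ⟨a, ha⟩
    refine MPair.mem_conj.2 ⟨a, ?_⟩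
    rw [mul_smul, mul_smul, ha, smul_comm, inv_smul_smul]

theorem FibSet.stabPair_smulA_eq {G : Type u} [Group G] {X : FibSet A G} (x : X) (a : A) :
    FibSet.stabPair (a • x) = FibSet.stabPair x := by
  refine FibSet.stabPair_eq (fun y hy => ?_) ?_
  · rw [smul_comm, FibSet.stabPair_smul x hy, smul_comm]
  · rintro y ⟨b, hb⟩
    refine ⟨b, ?_⟩
    rw [smul_comm, smul_comm b] at hb
    exact MulAction.injective a hb

namespace GroupSystem

variable (𝓢 : GroupSystem A) (R : Type v) [CommRing R]

/-- An object of `𝒟`: a member of `𝒢`. -/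
structure Obj (𝓢 : GroupSystem A) (R : Type v) [CommRing R] : Type (u + 1) where
  grp : CGroup.{u}
  mem : grp ∈ 𝓢.𝒢

instance : CoeSort (𝓢.Obj R) (Type u) := ⟨fun G => G.grp.carrier⟩

instance (G : 𝓢.Obj R) : Finite G := 𝓢.finite G.grp G.mem

variable {𝓢 R}

/-- The `R`-span of the classes `[G × H / (D, φ)]` with `(D, φ) ∈ 𝒮(G, H)`. -/
noncomputable def homSub (G H : 𝓢.Obj R) : Submodule R (BurnsideR R A (G × H)) :=
  Submodule.span R {x | ∃ p ∈ 𝓢.S G.grp H.grp,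
    x = clsR R (FibSet.coset (MPair.ofAmb G.grp H.grp p))}

theorem mem_homSub {G H : 𝓢.Obj R} (p : MPair A (G × H))
    (hp : p.toAmb (G := G.grp) (H := H.grp) ∈ 𝓢.S G.grp H.grp) :
    clsR R (FibSet.coset p) ∈ homSub G H :=
  Submodule.subset_span ⟨_, hp, by rw [MPair.ofAmb_toAmb]⟩

theorem cls_mem_homSub {G H : 𝓢.Obj R} (X : FibSet A (G × H))
    (hX : ∀ x : X, (FibSet.stabPair x).toAmb (G := G.grp) (H := H.grp) ∈ 𝓢.S G.grp H.grp) :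
    clsR R X ∈ homSub G H :=
  cls_mem ((homSub G H).toAddSubgroup.comap
    (TensorProduct.mk ℤ R (Burnside A (G × H)) 1).toAddMonoidHom) X
    fun x => mem_homSub _ (hX x)

theorem stabPair_coset_mem {G H : 𝓢.Obj R} {p : MPair A (G.grp.amb × H.grp.amb)}
    (hp : p ∈ 𝓢.S G.grp H.grp) (x : FibSet.coset (MPair.ofAmb G.grp H.grp p)) :
    (FibSet.stabPair x).toAmb (G := G.grp) (H := H.grp) ∈ 𝓢.S G.grp H.grp := by
  obtain ⟨⟨g, h⟩, a, rfl⟩ := FibSet.cosetMk_surj _ x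
  have : FibSet.cosetMk (MPair.ofAmb G.grp H.grp p) (g, h) a =
      a • ((g, h) : G × H) • FibSet.cosetMk (MPair.ofAmb G.grp H.grp p) 1 1 := by
    rw [FibSet.smul_cosetMk, FibSet.smulA_cosetMk, mul_one, mul_one]
  rw [this, FibSet.stabPair_smulA_eq, FibSet.stabPair_smul_eq, FibSet.stabPair_coset,
    MPair.toAmb_conj, MPair.toAmb_ofAmb (𝓢.S_le _ G.mem _ H.mem _ hp)]
  exact 𝓢.conj_mem _ G.mem _ H.mem _ hp _ g.2 _ h.2

/-- The subcategory is closed under composition. -/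
theorem tensR_mem {G H K : 𝓢.Obj R} {x : BurnsideR R A (G × H)} {y : BurnsideR R A (H × K)}
    (hx : x ∈ homSub G H) (hy : y ∈ homSub H K) : tensR R x y ∈ homSub G K := by
  induction hx using Submodule.span_induction with
  | zero => simp
  | add x x' _ _ h h' =>
    rw [map_add, LinearMap.add_apply]
    exact Submodule.add_mem _ h h'
  | smul r x _ h =>
    rw [map_smul, LinearMap.smul_apply]
    exact Submodule.smul_mem _ _ h
  | mem x hx =>
    induction hy using Submodule.span_induction with
    | zero => simp
    | add x x' _ _ h h' =>
      rw [map_add]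
      exact Submodule.add_mem _ h h'
    | smul r x _ h =>
      rw [map_smul]
      exact Submodule.smul_mem _ _ h
    | mem y hy =>
      obtain ⟨p, hp, rfl⟩ := hx
      obtain ⟨q, hq, rfl⟩ := hy
      rw [tensR_cls]
      refine cls_mem_homSub _ fun z => ?_
      obtain ⟨u, v, hf, rfl⟩ := FibSet.btmk_surj z
      rw [FibSet.stabPair_btmk, MPair.toAmb_star]
      exact 𝓢.star_mem _ G.mem _ H.mem _ K.mem _ (stabPair_coset_mem hp u) _
        (stabPair_coset_mem hq v) _

theorem tensR_coset {G H K : 𝓢.Obj R} {p : MPair A (G.grp.amb × H.grp.amb)}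
    {q : MPair A (H.grp.amb × K.grp.amb)} (hp : p ∈ 𝓢.S G.grp H.grp) (hq : q ∈ 𝓢.S H.grp K.grp)
    (hc : p.Compat q)
    (hd : ∀ h ∈ H.grp.carrier, ∃ h₁ h₂ g k, h = h₁ * h₂ ∧ (g, h₁) ∈ p.D ∧ (h₂, k) ∈ q.D) :
    tensR R (clsR R (FibSet.coset (MPair.ofAmb G.grp H.grp p)))
      (clsR R (FibSet.coset (MPair.ofAmb H.grp K.grp q))) =
    clsR R (FibSet.coset (MPair.ofAmb G.grp K.grp (p.star q hc))) := by
  have lp := 𝓢.S_le _ G.mem _ H.mem _ hp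
  have lq := 𝓢.S_le _ H.mem _ K.mem _ hq
  rw [← MPair.toAmb_ofAmb lp] at hc hd
  rw [← MPair.toAmb_ofAmb lq] at hc hd
  have hc' := MPair.toAmb_compat.1 hc
  have e : p.star q ‹_› = ((MPair.ofAmb G.grp H.grp p).star
      (MPair.ofAmb H.grp K.grp q) hc').toAmb := by
    rw [MPair.toAmb_star]
    congr 1
    · exact (MPair.toAmb_ofAmb lp).symm
    · exact (MPair.toAmb_ofAmb lq).symm
  rw [tensR_cls, e, MPair.ofAmb_toAmb]
  refine congrArg (fun t => (1 : R) ⊗ₜ t) (cls_eq (FibSet.coset_tens _ _ hc' fun h => ?_))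
  obtain ⟨h₁, h₂, g, k, e, m₁, m₂⟩ := hd h h.2
  obtain ⟨g, h₁, m₁, rfl, rfl⟩ := MPair.exists_of_mem_toAmb m₁
  obtain ⟨h₂, k, m₂, rfl, rfl⟩ := MPair.exists_of_mem_toAmb m₂
  exact ⟨h₁, h₂, g, k, Subtype.ext e, MPair.mem_toAmb.1 m₁, MPair.mem_toAmb.1 m₂⟩

theorem delta_star {G H : Type u} [Group G] [Group H] (p : MPair A (G × H)) (K : Subgroup G)
    (hK : ∀ x ∈ p.D, x.1 ∈ K) :
    (MPair.delta A K).star p (MPair.delta_compat K p) = p := by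
  refine MPair.ext' (fun x => ⟨?_, fun hx => ?_⟩) (fun x hx hx' => ?_)
  · rintro ⟨h, h₁, h₂⟩
    obtain ⟨-, e⟩ := MPair.mem_delta.1 h₁
    exact (Prod.ext e rfl : x = (h, x.2)) ▸ h₂
  · exact ⟨x.1, MPair.mem_delta.2 ⟨hK _ hx, rfl⟩, hx⟩
  · exact (MPair.star_φ (MPair.mem_delta.2 ⟨hK _ hx', rfl⟩) hx' hx).trans (one_mul _)

theorem star_delta {G H : Type u} [Group G] [Group H] (p : MPair A (G × H)) (K : Subgroup H)
    (hK : ∀ x ∈ p.D, x.2 ∈ K) :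
    p.star (MPair.delta A K) (MPair.compat_delta p K) = p := by
  refine MPair.ext' (fun x => ⟨?_, fun hx => ?_⟩) (fun x hx hx' => ?_)
  · rintro ⟨h, h₁, h₂⟩
    obtain ⟨-, e⟩ := MPair.mem_delta.1 h₂
    exact (Prod.ext rfl e.symm : x = (x.1, h)) ▸ h₁
  · exact ⟨x.2, hx, MPair.mem_delta.2 ⟨hK _ hx, rfl⟩⟩
  · exact (MPair.star_φ hx' (MPair.mem_delta.2 ⟨hK _ hx', rfl⟩) hx).trans (mul_one _)

/-- The identity `[G × G / (Δ(G), 1)]`. -/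
noncomputable def idCls (G : 𝓢.Obj R) : BurnsideR R A (G × G) :=
  clsR R (FibSet.coset (MPair.ofAmb G.grp G.grp (MPair.delta A G.grp.carrier)))

theorem id_tensR {G H : 𝓢.Obj R} {x : BurnsideR R A (G × H)} (hx : x ∈ homSub G H) :
    tensR R (idCls G) x = x := by
  induction hx using Submodule.span_induction with
  | zero => simp
  | add x x' _ _ h h' => rw [map_add, h, h']
  | smul r x _ h => rw [map_smul, h]
  | mem x hx =>
    obtain ⟨p, hp, rfl⟩ := hx
    refine (tensR_coset (𝓢.delta_mem _ G.mem) hp (MPair.delta_compat _ _) fun h hh =>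
      ⟨h, 1, h, 1, (mul_one h).symm, MPair.mem_delta.2 ⟨hh, rfl⟩, p.D.one_mem⟩).trans ?_
    rw [delta_star _ _ fun x hx => (𝓢.S_le _ G.mem _ H.mem _ hp hx).1]

theorem tensR_id {G H : 𝓢.Obj R} {x : BurnsideR R A (G × H)} (hx : x ∈ homSub G H) :
    tensR R x (idCls H) = x := by
  induction hx using Submodule.span_induction with
  | zero => simp
  | add x x' _ _ h h' => rw [map_add, LinearMap.add_apply, h, h']
  | smul r x _ h => rw [map_smul, LinearMap.smul_apply, h]
  | mem x hx =>
    obtain ⟨p, hp, rfl⟩ := hx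
    refine (tensR_coset hp (𝓢.delta_mem _ H.mem) (MPair.compat_delta _ _) fun h hh =>
      ⟨1, h, 1, h, (one_mul h).symm, p.D.one_mem, MPair.mem_delta.2 ⟨hh, rfl⟩⟩).trans ?_
    rw [star_delta _ _ fun x hx => (𝓢.S_le _ G.mem _ H.mem _ hp hx).2]

/-- The category `𝒟`. Morphisms `H ⟶ G` are the elements of the span `homSub G H` in
`B^A_R(G, H)`, and composition is the tensor product. -/
noncomputable instance : Category (𝓢.Obj R) where
  Hom H G := homSub G H
  id G := ⟨idCls G, Submodule.subset_span ⟨_, 𝓢.delta_mem _ G.mem, rfl⟩⟩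
  comp f g := ⟨tensR R g.1 f.1, tensR_mem g.2 f.2⟩
  id_comp f := Subtype.ext (tensR_id f.2)
  comp_id f := Subtype.ext (id_tensR f.2)
  assoc f g h := Subtype.ext (tensR_assoc R h.1 g.1 f.1).symm

noncomputable instance : Preadditive (𝓢.Obj R) where
  homGroup H G := inferInstanceAs (AddCommGroup (homSub G H))
  add_comp _ _ _ f f' g := Subtype.ext (map_add (tensR R g.1) f.1 f'.1)
  comp_add _ _ _ f g g' := Subtype.ext (LinearMap.map_add₂ (tensR R) g.1 g'.1 f.1)

noncomputable instance : Linear R (𝓢.Obj R) where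
  homModule H G := inferInstanceAs (Module R (homSub G H))
  smul_comp _ _ _ r f g := Subtype.ext (map_smul (tensR R g.1) r f.1)
  comp_smul _ _ _ f r g := Subtype.ext (LinearMap.map_smul₂ (tensR R) r g.1 f.1)

/-- The morphism `[G × H / (D, φ)] : H ⟶ G` of `𝒟`, for `(D, φ) ∈ 𝒮(G, H)`. -/
noncomputable def mor {G H : 𝓢.Obj R} (p : MPair A (G.grp.amb × H.grp.amb))
    (hp : p ∈ 𝓢.S G.grp H.grp) : H ⟶ G :=
  ⟨clsR R (FibSet.coset (MPair.ofAmb G.grp H.grp p)), Submodule.subset_span ⟨p, hp, rfl⟩⟩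

theorem mor_comp {G H K : 𝓢.Obj R} {p : MPair A (G.grp.amb × H.grp.amb)}
    {q : MPair A (H.grp.amb × K.grp.amb)} (hp : p ∈ 𝓢.S G.grp H.grp) (hq : q ∈ 𝓢.S H.grp K.grp)
    (hc : p.Compat q)
    (hd : ∀ h ∈ H.grp.carrier, ∃ h₁ h₂ g k, h = h₁ * h₂ ∧ (g, h₁) ∈ p.D ∧ (h₂, k) ∈ q.D) :
    mor q hq ≫ mor p hp =
      mor (p.star q hc) (𝓢.star_mem _ G.mem _ H.mem _ K.mem _ hp _ hq hc) :=
  Subtype.ext (tensR_coset hp hq hc hd)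

end GroupSystem

end Category

/-! ### The categories `Γ_F(G)` and the functors `Γ_F(U)` -/

section Gamma

variable {A : Type u} [CommGroup A]

/-- The stabilizer `G_x` of the `A`-orbit of `x`, as a subgroup of the ambient group of `G`. -/
def ambStab {G : CGroup.{u}} {X : FibSet A G} (x : X) : Subgroup G.amb :=
  (FibSet.stab x).map G.carrier.subtype

theorem mem_ambStab {G : CGroup.{u}} {X : FibSet A G} {x : X} {g : G} :
    (g : G.amb) ∈ ambStab x ↔ g ∈ FibSet.stab x :=
  Subgroup.mem_map_iff_mem G.carrier.subtype_injective

theorem ambStab_le {G : CGroup.{u}} {X : FibSet A G} (x : X) : ambStab x ≤ G.carrier := by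
  rintro _ ⟨g, -, rfl⟩
  exact g.2

theorem mem_ambStab_smul {G : CGroup.{u}} {X : FibSet A G} (x : X) (g : G) (a : A) (y : G.amb) :
    y ∈ ambStab (a • g • x) ↔ (g : G.amb)⁻¹ * y * g ∈ ambStab x := by
  have h : ∀ k : G, k ∈ FibSet.stab (a • g • x) ↔ g⁻¹ * k * g ∈ FibSet.stab x := by
    intro k
    change k ∈ (FibSet.stabPair (a • g • x)).D ↔ _
    rw [FibSet.stabPair_smulA_eq, FibSet.stabPair_smul_eq, MPair.mem_conj]
    rfl
  constructor
  · rintro ⟨k, hk, rfl⟩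
    exact mem_ambStab.2 ((h k).1 hk)
  · rintro hy
    obtain ⟨k, hk, e⟩ := hy
    have : y = (g * k * g⁻¹ : G) := by
      have e : (k : G.amb) = (g : G.amb)⁻¹ * y * g := e
      push_cast
      rw [e]
      group
    subst this
    refine mem_ambStab.2 ((h _).2 ?_)
    have : g⁻¹ * (g * k * g⁻¹) * g = k := by group
    rwa [this]

/-- `G_x` as a group. -/
abbrev stabGrp {G : CGroup.{u}} {X : FibSet A G} (x : X) : CGroup.{u} := G.sub (ambStab x)

theorem conj_delta_compat {Γ K : Type u} [Group Γ] [Group K] (P : Subgroup Γ) (g : Γ)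
    (p : MPair A (Γ × K)) : ((MPair.delta A P).conj (g, 1)).Compat p := by
  intro h h₁ h₂
  obtain ⟨-, e⟩ := MPair.mem_delta.1 (MPair.mem_conj.1 h₁ : (g⁻¹ * 1 * g, (1 : Γ)⁻¹ * h * 1) ∈ _)
  obtain rfl : h = 1 := by simpa using e.symm
  exact (congrArg _ (map_one ((MPair.delta A P).conj (g, 1)).φ)).trans
    (inv_one.trans (map_one p.φ).symm)

theorem compat_conj_delta {Γ K : Type u} [Group Γ] [Group K] (P : Subgroup Γ) (g : Γ)
    (p : MPair A (K × Γ)) : p.Compat ((MPair.delta A P).conj (g, 1)) := by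
  intro h h₁ h₂
  obtain ⟨-, e⟩ := MPair.mem_delta.1 (MPair.mem_conj.1 h₂ : (g⁻¹ * h * g, (1 : Γ)⁻¹ * 1 * 1) ∈ _)
  obtain rfl : h = 1 := by
    have e : g⁻¹ * h * g = 1 := by simpa using e
    have : h = g * (g⁻¹ * h * g) * g⁻¹ := by group
    rw [this, e]
    group
  exact (congrArg _ (map_one p.φ)).trans
    (inv_one.trans (map_one ((MPair.delta A P).conj (g, 1)).φ).symm)

theorem mem_conj_delta {Γ : Type u} [Group Γ] {P : Subgroup Γ} {g x y : Γ} :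
    (x, y) ∈ ((MPair.delta A P).conj (g, 1)).D ↔ y ∈ P ∧ x = g * y * g⁻¹ := by
  refine MPair.mem_conj.trans ((MPair.mem_delta (x := g⁻¹ * x * g) (y := 1⁻¹ * y * 1)).trans ?_)
  constructor
  · rintro ⟨h, e⟩
    obtain rfl : y = g⁻¹ * x * g := by simpa using e.symm
    exact ⟨h, by group⟩
  · rintro ⟨h, rfl⟩
    have e : g⁻¹ * (g * y * g⁻¹) * g = y := by group
    rw [e]
    exact ⟨h, by simp⟩

theorem conj_delta_φ {Γ : Type u} [Group Γ] (P : Subgroup Γ) (g : Γ × Γ) (x) :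
    ((MPair.delta A P).conj g).φ x = 1 := by
  obtain ⟨x, hx⟩ := x
  exact MPair.conj_φ' _ _ _ hx

namespace GroupSystem

variable {𝓢 : GroupSystem A} {R : Type v} [CommRing R]

theorem conj_delta_mem (G : CGroup.{u}) (hG : G ∈ 𝓢.𝒢) {P P' : Subgroup G.amb}
    (hP : P ≤ G.carrier) (hP𝒢 : G.sub P ∈ 𝓢.𝒢) (g : G.amb) (hg : g ∈ G.carrier)
    (h : ∀ y, y ∈ P' ↔ g⁻¹ * y * g ∈ P) :
    (MPair.delta A P).conj (g, 1) ∈ 𝓢.S (G.sub P') (G.sub P) := by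
  have h1 := 𝓢.conj_mem G hG G hG _ (𝓢.delta_mem G hG) g hg 1 G.carrier.one_mem
  have h2 := 𝓢.star_delta_mem G hG G hG _ h1 P hP hP𝒢
  have e1 : starSet ((MPair.delta A G.carrier).conj (g, 1)).D P = P' := by
    ext y
    rw [h]
    constructor
    · rintro ⟨z, hz, hm⟩
      obtain ⟨-, rfl⟩ := mem_conj_delta.1 hm
      have e : g⁻¹ * (g * z * g⁻¹) * g = z := by group
      rwa [e]
    · intro hy
      exact ⟨_, hy, mem_conj_delta.2 ⟨hP hy, by group⟩⟩
  have e2 : ((MPair.delta A G.carrier).conj (g, 1)).star (MPair.delta A P)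
      (MPair.compat_delta _ _) = (MPair.delta A P).conj (g, 1) := by
    refine MPair.ext' (fun x => ⟨?_, fun hx => ?_⟩) (fun x hx hx' => ?_)
    · rintro ⟨z, h1, h2⟩
      obtain ⟨hz, e⟩ := MPair.mem_delta.1 h2
      obtain ⟨-, e'⟩ := mem_conj_delta.1 h1
      exact mem_conj_delta.2 ⟨e ▸ hz, e ▸ e'⟩
    · obtain ⟨hz, e⟩ := mem_conj_delta.1 hx
      exact ⟨x.2, mem_conj_delta.2 ⟨hP hz, e⟩, MPair.mem_delta.2 ⟨hz, rfl⟩⟩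
    · obtain ⟨hz, e⟩ := mem_conj_delta.1 hx'
      refine (MPair.star_φ (mem_conj_delta.2 ⟨hP hz, e⟩) (MPair.mem_delta.2 ⟨hz, rfl⟩) hx).trans ?_
      rw [conj_delta_φ, conj_delta_φ, one_mul]
      rfl
  rw [e1, e2] at h2
  exact h2

variable (F : 𝓢.Obj R ⥤ ModuleCat.{w} R)

/-- The group `G_x`, an object of `𝒟`. -/
abbrev stabObj {G : 𝓢.Obj R} {X : FibSet A G} (hX : ∀ x : X, stabGrp (G := G.grp) x ∈ 𝓢.𝒢)
    (x : X) : 𝓢.Obj R := ⟨stabGrp (G := G.grp) x, hX x⟩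

/-- The morphism `Iso(C_g) = [G_x × G_y / ({(g k g⁻¹, k) | k ∈ G_y}, 1)] : G_y ⟶ G_x` of `𝒟`, where
`y = g⁻¹ a x` and `C_g : G_y → G_x` is conjugation by `g`. -/
noncomputable def isoConj {G : 𝓢.Obj R} {X : FibSet A G}
    (hX : ∀ x : X, stabGrp (G := G.grp) x ∈ 𝓢.𝒢) (g : G) (a : A) (x y : X) (h : y = g⁻¹ • a • x) :
    stabObj hX y ⟶ stabObj hX x :=
  mor (G := stabObj hX x) (H := stabObj hX y)
    ((MPair.delta A (ambStab (G := G.grp) y)).conj ((g : G.grp.amb), 1))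
    (conj_delta_mem G.grp G.mem (ambStab_le y) (hX y) g g.2 fun z => by
      have : x = a⁻¹ • g • y := by rw [h, smul_inv_smul, inv_smul_smul]
      rw [this]
      exact mem_ambStab_smul (G := G.grp) y g a⁻¹ z)

/-- An object `(X, s)` of `Γ_F(G)`: an `A`-fibered `G`-set `X` with all `G_x` in `𝒢` and a
`(G × A)`-invariant section `s` of `F` over `X`: `s(x) ∈ F(G_x)` and
`F(Iso(C_g))(s(g⁻¹ a x)) = s(x)` for all `x ∈ X`, `g ∈ G`, `a ∈ A`. -/
structure Gamma (G : 𝓢.Obj R) where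
  X : FibSet A G
  mem : ∀ x : X, stabGrp (G := G.grp) x ∈ 𝓢.𝒢
  s : ∀ x : X, F.obj (stabObj mem x)
  inv : ∀ (g : G) (a : A) (x : X),
    (F.map (isoConj mem g a x (g⁻¹ • a • x) rfl)).hom (s (g⁻¹ • a • x)) = s x

variable {F}

/-- Morphisms `(X, s) → (Y, t)` of `Γ_F(G)`: equivariant maps `α : X → Y` with
`G_{α(x)} = G_x` and `t(α(x)) = s(x)` for all `x`. -/
@[ext] structure Gamma.Hom {G : 𝓢.Obj R} (X Y : Gamma F G) where
  map : FibSet.Hom X.X Y.X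
  stab_eq : ∀ x, FibSet.stab (map x) = FibSet.stab x
  s_eq : ∀ x, HEq (Y.s (map x)) (X.s x)

instance (G : 𝓢.Obj R) : Category (Gamma F G) where
  Hom X Y := Gamma.Hom X Y
  id X := ⟨.id X.X, fun _ => rfl, fun _ => HEq.rfl⟩
  comp f g := ⟨f.map.comp g.map, fun x => (g.stab_eq _).trans (f.stab_eq x),
    fun x => (g.s_eq _).trans (f.s_eq x)⟩

theorem Gamma.inv' {G : 𝓢.Obj R} (X : Gamma F G) (g : G) (a : A) (x y : X.X)
    (h : y = g⁻¹ • a • x) : (F.map (isoConj X.mem g a x y h)).hom (X.s y) = X.s x := by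
  subst h
  exact X.inv g a x

end GroupSystem

section ActTens

variable {G H : Type u} [Group G] [Group H]

/-- The orbit of `(u, x)`, before the condition of `A`-freeness. -/
def FibSet.amk (U : FibSet A (G × H)) (X : FibSet A H) (u : U) (x : X) :
    PreTens U (X.comap (MonoidHom.snd G H)) :=
  PreTens.mk u (show X.comap _ from x)

theorem FibSet.amk_eq {U : FibSet A (G × H)} {X : FibSet A H} {u u' : U} {x x' : X} :
    U.amk X u x = U.amk X u' x' ↔ ∃ (h : H) (a : A),
      u' = a⁻¹ • ((1, h) : G × H) • u ∧ x' = a • h • x :=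
  PreTens.mk_eq

theorem FibSet.amk_smul {U : FibSet A (G × H)} {X : FibSet A H} (g : G) (u : U) (x : X) :
    g • U.amk X u x = U.amk X (((g, 1) : G × H) • u) x :=
  congrArg (fun t => U.amk X (((g, 1) : G × H) • u) t) (one_smul H x)

theorem FibSet.amk_smulA {U : FibSet A (G × H)} {X : FibSet A H} (a : A) (u : U) (x : X) :
    a • U.amk X u x = U.amk X (a • u) x := rfl

theorem FibSet.amk_free {U : FibSet A (G × H)} {X : FibSet A H} {u : U} {x : X} :
    (U.amk X u x).Free ↔ ∀ (h : H) (a c : A), c • u = a⁻¹ • ((1, h) : G × H) • u →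
      x = a • h • x → c = 1 := by
  rw [PreTens.free_iff]
  constructor
  · intro hf h a c h1 h2
    refine hf c ?_
    rw [FibSet.amk_smulA, eq_comm, FibSet.amk_eq]
    exact ⟨h, a, h1, h2⟩
  · intro hf c hc
    rw [FibSet.amk_smulA, eq_comm, FibSet.amk_eq] at hc
    obtain ⟨h, a, h1, h2⟩ := hc
    exact hf h a c h1 h2

theorem FibSet.exists_amk {U : FibSet A (G × H)} {X : FibSet A H} (q : U.actTens X) :
    ∃ u x, U.amk X u x = q.1 := by
  obtain ⟨⟨u, x⟩, h⟩ := q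
  exact ⟨u, x, rfl⟩

/-- `G_{u ⊗ x} = (G × H)_u ∗ H_x`. -/
theorem FibSet.mem_stab_act {U : FibSet A (G × H)} {X : FibSet A H} {u : U} {x : X}
    {q : U.actTens X} (hq : U.amk X u x = q.1) (g : G) :
    g ∈ FibSet.stab q ↔ ∃ h ∈ FibSet.stab x, (g, h) ∈ FibSet.stab u := by
  have key : ∀ a : A, g • q = a • q ↔ ∃ (h : H) (b : A),
      a • u = b⁻¹ • ((1, h) : G × H) • ((g, 1) : G × H) • u ∧ x = b • h • x := by
    intro a
    rw [← FibSet.amk_eq, ← FibSet.amk_smul, ← FibSet.amk_smulA, hq]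
    exact Subtype.ext_iff
  constructor
  · rintro ⟨a, ha⟩
    obtain ⟨h, b, e1, e2⟩ := (key a).1 ha
    rw [smul_smul ((1, h) : G × H)] at e1
    simp only [Prod.mk_mul_mk, one_mul, mul_one] at e1
    exact ⟨h, ⟨b⁻¹, by rw [eq_inv_smul_iff]; exact e2.symm⟩,
      ⟨b * a, by rw [mul_smul, e1, smul_inv_smul]⟩⟩
  · rintro ⟨h, ⟨b, hb⟩, ⟨c, hc⟩⟩
    refine ⟨b * c, (key _).2 ⟨h, b⁻¹, ?_, ?_⟩⟩
    · rw [smul_smul ((1, h) : G × H)]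
      simp only [Prod.mk_mul_mk, one_mul, mul_one]
      rw [hc, inv_inv, mul_smul]
    · rw [hb, inv_smul_smul]

/-- `U ⊗ α`, before the condition of `A`-freeness. -/
def PreTens.mapRight (U : FibSet A (G × H)) {X Y : FibSet A H} (α : FibSet.Hom X Y) :
    PreTens U (X.comap (MonoidHom.snd G H)) → PreTens U (Y.comap (MonoidHom.snd G H)) :=
  Quotient.lift (fun p => U.amk Y p.1 (α p.2)) (by
    rintro ⟨u, x⟩ ⟨u', x'⟩ ⟨h, a, e1, e2⟩
    refine FibSet.amk_eq.2 ⟨h, a, e1, ?_⟩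
    have e2 : x' = a • h • (show X from x) := e2
    change α x' = _
    rw [e2, α.map_smulA, α.map_smul])

/-- `U ⊗_{AH} α` for a map `α` that preserves the stabilizers of `A`-orbits. -/
def FibSet.Hom.actTens (U : FibSet A (G × H)) {X Y : FibSet A H} (α : FibSet.Hom X Y)
    (hα : ∀ x, FibSet.stab (α x) = FibSet.stab x) : FibSet.Hom (U.actTens X) (U.actTens Y) where
  toFun q := ⟨PreTens.mapRight U α q.1, by
    obtain ⟨⟨u, x⟩, hq⟩ := q
    refine FibSet.amk_free.2 fun h a c e1 e2 => FibSet.amk_free.1 hq h a c e1 ?_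
    have hh : h ∈ FibSet.stab (α x) :=
      ⟨a⁻¹, by rw [eq_inv_smul_iff]; exact e2.symm⟩
    obtain ⟨b, hb⟩ : h ∈ FibSet.stab (X := X) x := (hα x) ▸ hh
    have hb : h • (show X from x) = b • (show X from x) := hb
    have hb' : h • α x = b • α x := (α.map_smul h x).symm.trans
      ((congrArg α hb).trans (α.map_smulA b x))
    have e2 : α x = a • h • α x := e2
    rw [hb', smul_smul] at e2
    have this : (1 : A) = a * b := Y.free _ _ (α x) (by rw [one_smul]; exact e2)
    change (show X from x) = a • h • (show X from x)
    rw [hb, smul_smul, ← this, one_smul]⟩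
  map_smul g q := by
    obtain ⟨⟨u, x⟩, hq⟩ := q
    refine Subtype.ext ?_
    refine (congrArg (PreTens.mapRight U α) (FibSet.amk_smul g u x)).trans ?_
    exact (FibSet.amk_smul g u (α x)).symm
  map_smulA a q := by
    obtain ⟨⟨u, x⟩, hq⟩ := q
    rfl

theorem FibSet.Hom.actTens_mk (U : FibSet A (G × H)) {X Y : FibSet A H} (α : FibSet.Hom X Y)
    (hα : ∀ x, FibSet.stab (α x) = FibSet.stab x) {u : U} {x : X} {q : U.actTens X}
    (hq : U.amk X u x = q.1) : U.amk Y u (α x) = (FibSet.Hom.actTens U α hα q).1 := by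
  change _ = PreTens.mapRight U α q.1
  rw [← hq]
  rfl

end ActTens

namespace GroupSystem

variable {𝓢 : GroupSystem A} {R : Type v} [CommRing R]

/-- `𝒮₊(G, H)`: the pairs `(D, φ) ∈ ℳ(G × H)` with `p₁(D) ∈ 𝒢` and `(D, φ) ∈ 𝒮(p₁(D), H)`. -/
def SPlus (𝓢 : GroupSystem A) (G H : CGroup.{u}) : Set (MPair A (G.amb × H.amb)) :=
  {p | p.D ≤ G.carrier.prod H.carrier ∧ G.sub (proj₁ p.D) ∈ 𝓢.𝒢 ∧
    p ∈ 𝓢.S (G.sub (proj₁ p.D)) H}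

/-- The stabilizing pair `((G × H)_u, φ_u) ∈ ℳ(G × H)` of an element of a biset. -/
noncomputable def bisetPair {G H : CGroup.{u}} {U : FibSet A (G × H)} (u : U) :
    MPair A (G.amb × H.amb) := (FibSet.stabPair u).toAmb

/-- The pair `((G × H_x)_u, φ_{u,x}) = ((G × H)_u, φ_u) ∗ (Δ(H_x), 1)`. -/
noncomputable def actPair {G H : CGroup.{u}} {U : FibSet A (G × H)} {X : FibSet A H}
    (u : U) (x : X) : MPair A (G.amb × H.amb) :=
  (bisetPair u).star (MPair.delta A (ambStab x)) (MPair.compat_delta _ _)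

theorem ambStab_act {G H : CGroup.{u}} {U : FibSet A (G × H)} {X : FibSet A H} {u : U} {x : X}
    {q : U.actTens X} (hq : U.amk X u x = q.1) :
    ambStab q = starSet (bisetPair u).D (ambStab x) := by
  ext y
  constructor
  · rintro ⟨g, hg, rfl⟩
    obtain ⟨h, hh, hm⟩ := (FibSet.mem_stab_act hq g).1 hg
    exact ⟨h, mem_ambStab.2 hh, MPair.mem_toAmb.2 hm⟩
  · rintro ⟨h, hh, hm⟩
    have hm' := hm
    obtain ⟨g, h, -, rfl, rfl⟩ := MPair.exists_of_mem_toAmb hm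
    exact mem_ambStab.2 ((FibSet.mem_stab_act hq g).2 ⟨h, mem_ambStab.1 hh, MPair.mem_toAmb.1 hm'⟩)

theorem stab_act_mem {G H : CGroup.{u}} (hH : H ∈ 𝓢.𝒢)
    {U : FibSet A (G × H)} (hU : ∀ u : U, bisetPair u ∈ 𝓢.SPlus G H) {X : FibSet A H}
    (hX : ∀ x : X, stabGrp x ∈ 𝓢.𝒢) (q : U.actTens X) : stabGrp q ∈ 𝓢.𝒢 := by
  obtain ⟨u, x, hq⟩ := FibSet.exists_amk q
  change G.sub (ambStab q) ∈ _
  rw [ambStab_act hq]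
  exact 𝓢.starSet_mem _ (hU u).2.1 _ hH _ (hU u).2.2 _ (ambStab_le (X := X) x) (hX x)

theorem actPair_mem {G H : CGroup.{u}} (hH : H ∈ 𝓢.𝒢)
    {U : FibSet A (G × H)} (hU : ∀ u : U, bisetPair u ∈ 𝓢.SPlus G H) {X : FibSet A H}
    (hX : ∀ x : X, stabGrp x ∈ 𝓢.𝒢) {u : U} {x : X} {q : U.actTens X}
    (hq : U.amk X u x = q.1) : actPair u x ∈ 𝓢.S (stabGrp q) (stabGrp x) := by
  change _ ∈ 𝓢.S (G.sub (ambStab q)) _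
  rw [ambStab_act hq]
  exact 𝓢.star_delta_mem _ (hU u).2.1 _ hH _ (hU u).2.2 _ (ambStab_le x) (hX x)

variable {F : 𝓢.Obj R ⥤ ModuleCat.{w} R} {G H : 𝓢.Obj R}

/-- The morphism `[G_{u ⊗ x} × H_x / ((G × H_x)_u, φ_{u,x})] : H_x ⟶ G_{u ⊗ x}` of `𝒟`, where
`q = u ⊗ x`. -/
noncomputable def actMor {U : FibSet A (G × H)}
    (hU : ∀ u : U, bisetPair (G := G.grp) (H := H.grp) u ∈ 𝓢.SPlus G.grp H.grp) {X : FibSet A H}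
    (hX : ∀ x : X, stabGrp (G := H.grp) x ∈ 𝓢.𝒢) (u : U) (x : X) (q : U.actTens X)
    (hq : U.amk X u x = q.1) :
    stabObj hX x ⟶ stabObj (G := G) (stab_act_mem H.mem hU hX) q :=
  mor (G := stabObj (G := G) (stab_act_mem H.mem hU hX) q) (H := stabObj hX x)
    (actPair (G := G.grp) (H := H.grp) u x) (actPair_mem H.mem hU hX hq)

/-- The section `U(s)` of `F` over `U ⊗_{AH} X`, computed at `q` with a chosen representative
`q = u ⊗ x` as `F([G_{u ⊗ x} × H_x / ((G × H_x)_u, φ_{u,x})])(s(x))`; by `actSec_eq` the value is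
the same for every representative. -/
noncomputable def actSec {U : FibSet A (G × H)}
    (hU : ∀ u : U, bisetPair (G := G.grp) (H := H.grp) u ∈ 𝓢.SPlus G.grp H.grp) (X : Gamma F H)
    (q : U.actTens X.X) : F.obj (stabObj (G := G) (stab_act_mem H.mem hU X.mem) q) :=
  (F.map (actMor hU X.mem q.1.out.1 q.1.out.2 q (Quotient.out_eq q.1))).hom (X.s q.1.out.2)

theorem mor_congr {G H : 𝓢.Obj R} {p p' : MPair A (G.grp.amb × H.grp.amb)}
    {hp : p ∈ 𝓢.S G.grp H.grp} {hp' : p' ∈ 𝓢.S G.grp H.grp} (h : p = p') :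
    mor p hp = mor p' hp' := by
  subst h
  rfl

theorem star_conj_delta {Γ Λ : Type u} [Group Γ] [Group Λ] (p : MPair A (Γ × Λ)) (h : Λ)
    {K K' : Subgroup Λ} (hK : ∀ y, y ∈ K' ↔ h⁻¹ * y * h ∈ K)
    (hc : ((p.conj (1, h)).star (MPair.delta A K') (MPair.compat_delta _ _)).Compat
      ((MPair.delta A K).conj (h, 1))) :
    ((p.conj (1, h)).star (MPair.delta A K') (MPair.compat_delta _ _)).star
      ((MPair.delta A K).conj (h, 1)) hc =
    p.star (MPair.delta A K) (MPair.compat_delta _ _) := by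
  have e0 : ∀ k : Λ, h⁻¹ * (h * k * h⁻¹) * h = k := fun k => by group
  have key : ∀ {x : Γ} {k : Λ}, (x, k) ∈ p.D → k ∈ K →
      (x, h * k * h⁻¹) ∈ (p.conj (1, h)).D ∧ h * k * h⁻¹ ∈ K' := by
    intro x k hx hk
    refine ⟨MPair.mem_conj.2 ?_, (hK _).2 (by rwa [e0])⟩
    simpa [e0, mul_assoc] using hx
  refine MPair.ext' (fun x => ⟨?_, ?_⟩) (fun x hx hx' => ?_)
  · obtain ⟨x, k⟩ := x
    rintro ⟨l, ⟨l', h1, h2⟩, h3⟩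
    obtain ⟨hl, rfl⟩ := MPair.mem_delta.1 h2
    obtain ⟨hk, rfl⟩ := mem_conj_delta.1 h3
    refine ⟨k, ?_, MPair.mem_delta.2 ⟨hk, rfl⟩⟩
    have := MPair.mem_conj.1 h1
    simpa [e0, mul_assoc] using this
  · obtain ⟨x, k⟩ := x
    rintro ⟨l, h1, h2⟩
    obtain ⟨hk, rfl⟩ := MPair.mem_delta.1 h2
    obtain ⟨h3, h4⟩ := key h1 hk
    exact MPair.mem_star.2 ⟨h * l * h⁻¹, MPair.mem_star.2 ⟨_, h3, MPair.mem_delta.2 ⟨h4, rfl⟩⟩,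
      mem_conj_delta.2 ⟨hk, rfl⟩⟩
  · obtain ⟨x, k⟩ := x
    obtain ⟨l, h1, h2⟩ := id hx'
    obtain ⟨hk, rfl⟩ := MPair.mem_delta.1 h2
    obtain ⟨h3, h4⟩ := key h1 hk
    refine (MPair.star_φ (q := (MPair.delta A K).conj (h, 1))
      (MPair.mem_star.2 ⟨_, h3, MPair.mem_delta.2 ⟨h4, rfl⟩⟩) (mem_conj_delta.2 ⟨hk, rfl⟩) hx).trans ?_
    rw [conj_delta_φ, mul_one]
    refine (MPair.star_φ h3 (MPair.mem_delta.2 ⟨h4, rfl⟩) _).trans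
      (Eq.trans ?_ (MPair.star_φ h1 h2 hx').symm)
    refine congrArg₂ (· * ·) ?_ rfl
    refine (MPair.conj_φ' _ _ _ h3).trans (congrArg p.φ (Subtype.ext ?_))
    exact Prod.ext (by simp) (by simp [mul_assoc])

theorem conj_delta_star {Γ Λ : Type u} [Group Γ] [Group Λ] (p : MPair A (Γ × Λ)) (g : Γ)
    {P : Subgroup Γ} {K : Subgroup Λ} (hP : starSet p.D K ≤ P)
    (hc : ((MPair.delta A P).conj (g, 1)).Compat
      (p.star (MPair.delta A K) (MPair.compat_delta _ _))) :
    ((MPair.delta A P).conj (g, 1)).star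
      (p.star (MPair.delta A K) (MPair.compat_delta _ _)) hc =
    (p.conj (g, 1)).star (MPair.delta A K) (MPair.compat_delta _ _) := by
  have e0 : ∀ k : Γ, g⁻¹ * (g * k * g⁻¹) * g = k := fun k => by group
  have key : ∀ {x : Γ} {k : Λ}, (x, k) ∈ (p.conj (g, 1)).D → (g⁻¹ * x * g, k) ∈ p.D := by
    intro x k hx
    simpa [e0, mul_assoc] using MPair.mem_conj.1 hx
  refine MPair.ext' (fun x => ⟨?_, ?_⟩) (fun x hx hx' => ?_)
  · obtain ⟨x, k⟩ := x
    rintro ⟨l, h3, ⟨l', h1, h2⟩⟩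
    obtain ⟨hl, rfl⟩ := MPair.mem_delta.1 h2
    obtain ⟨hk, rfl⟩ := mem_conj_delta.1 h3
    refine ⟨l', MPair.mem_conj.2 ?_, h2⟩
    simpa [e0, mul_assoc] using h1
  · obtain ⟨x, k⟩ := x
    rintro ⟨l, h1, h2⟩
    obtain ⟨hk, rfl⟩ := MPair.mem_delta.1 h2
    have h3 := key h1
    exact MPair.mem_star.2 ⟨g⁻¹ * x * g, mem_conj_delta.2 ⟨hP ⟨_, hk, h3⟩, by group⟩,
      MPair.mem_star.2 ⟨_, h3, h2⟩⟩
  · obtain ⟨x, k⟩ := x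
    obtain ⟨l, h1, h2⟩ := id hx'
    obtain ⟨hk, rfl⟩ := MPair.mem_delta.1 h2
    have h3 := key h1
    refine (MPair.star_φ (p := (MPair.delta A P).conj (g, 1))
      (mem_conj_delta.2 ⟨hP ⟨_, hk, h3⟩, by group⟩) (MPair.mem_star.2 ⟨_, h3, h2⟩) hx).trans ?_
    rw [conj_delta_φ, one_mul]
    refine (MPair.star_φ h3 h2 _).trans (Eq.trans ?_ (MPair.star_φ h1 h2 hx').symm)
    refine congrArg₂ (· * ·) ?_ rfl
    refine Eq.trans (congrArg p.φ (Subtype.ext ?_)) (MPair.conj_φ' _ _ _ h1).symm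
    exact Prod.ext (by simp) (by simp [mul_assoc])

theorem actSec_indep {U : FibSet A (G × H)}
    (hU : ∀ u : U, bisetPair (G := G.grp) (H := H.grp) u ∈ 𝓢.SPlus G.grp H.grp) (X : Gamma F H)
    (q : U.actTens X.X) {u u' : U} {x x' : X.X} (hq : U.amk X.X u x = q.1)
    (hq' : U.amk X.X u' x' = q.1) :
    (F.map (actMor hU X.mem u x q hq)).hom (X.s x) =
      (F.map (actMor hU X.mem u' x' q hq')).hom (X.s x') := by
  obtain ⟨h, a, e1, e2⟩ := FibSet.amk_eq.1 (hq.trans hq'.symm)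
  have e3 : x = h⁻¹ • a⁻¹ • x' := by rw [e2, inv_smul_smul, inv_smul_smul]
  rw [← X.inv' h a⁻¹ x' x e3]
  rw [← LinearMap.comp_apply, ← ModuleCat.hom_comp, ← F.map_comp]
  congr 3
  unfold actMor isoConj
  refine Eq.trans ?_ (mor_comp (G := stabObj (G := G) (stab_act_mem H.mem hU X.mem) q)
    (H := stabObj X.mem x') (K := stabObj X.mem x) _ _ (compat_conj_delta _ _ _) ?_).symm
  · refine mor_congr ?_
    have e4 : bisetPair (G := G.grp) (H := H.grp) u' =
        (bisetPair (G := G.grp) (H := H.grp) u).conj (1, (h : H.grp.amb)) := by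
      rw [e1, bisetPair, FibSet.stabPair_smulA_eq, FibSet.stabPair_smul_eq]
      exact MPair.toAmb_conj (G := G.grp) (H := H.grp) _ 1 h
    unfold actPair
    simp only [e4]
    refine (star_conj_delta _ _ (fun y => ?_) _).symm
    rw [e2]
    exact mem_ambStab_smul (G := H.grp) x h a y
  · intro k hk
    refine ⟨1, k, 1, (h : H.grp.amb)⁻¹ * k * h, (one_mul k).symm, one_mem _,
      mem_conj_delta.2 ⟨?_, by group⟩⟩
    have hk : k ∈ ambStab (G := H.grp) x' := hk
    rw [e2] at hk
    exact (mem_ambStab_smul (G := H.grp) x h a k).1 hk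

theorem actSec_eq {U : FibSet A (G × H)}
    (hU : ∀ u : U, bisetPair (G := G.grp) (H := H.grp) u ∈ 𝓢.SPlus G.grp H.grp) (X : Gamma F H)
    (q : U.actTens X.X) {u : U} {x : X.X} (hq : U.amk X.X u x = q.1) :
    actSec hU X q = (F.map (actMor hU X.mem u x q hq)).hom (X.s x) :=
  actSec_indep hU X q _ hq

/-- `Γ_F(U)(X, s) = (U ⊗_{AH} X, U(s))`. -/
noncomputable def gammaObj {U : FibSet A (G × H)}
    (hU : ∀ u : U, bisetPair (G := G.grp) (H := H.grp) u ∈ 𝓢.SPlus G.grp H.grp) (X : Gamma F H) :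
    Gamma F G where
  X := U.actTens X.X
  mem := stab_act_mem H.mem hU X.mem
  s := actSec hU X
  inv g a q := by
    obtain ⟨q', hq'⟩ : ∃ q', q' = g⁻¹ • a • q := ⟨_, rfl⟩
    have e : q = a⁻¹ • g • q' := by rw [hq', smul_inv_smul, inv_smul_smul]
    suffices h : (F.map (isoConj (stab_act_mem H.mem hU X.mem) g a q q' hq')).hom
        (actSec hU X q') = actSec hU X q by
      subst hq'
      exact h
    obtain ⟨u, x, hq⟩ := FibSet.exists_amk q'
    have hq2 : U.amk X.X (a⁻¹ • ((g, 1) : G × H) • u) x = q.1 := by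
      rw [e, ← FibSet.amk_smulA, ← FibSet.amk_smul, hq]
      rfl
    rw [actSec_eq hU X q' hq, actSec_eq hU X q hq2]
    rw [← LinearMap.comp_apply, ← ModuleCat.hom_comp, ← F.map_comp]
    congr 3
    unfold actMor isoConj
    refine (mor_comp (G := stabObj (G := G) (stab_act_mem H.mem hU X.mem) q)
      (H := stabObj (G := G) (stab_act_mem H.mem hU X.mem) q') (K := stabObj X.mem x) _ _
      (conj_delta_compat _ _ _) ?_).trans ?_
    · intro k hk
      exact ⟨k, 1, (g : G.grp.amb) * k * (g : G.grp.amb)⁻¹, 1, (mul_one k).symm,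
        mem_conj_delta.2 ⟨hk, rfl⟩, one_mem _⟩
    · refine mor_congr ?_
      have e4 : bisetPair (G := G.grp) (H := H.grp) (a⁻¹ • ((g, 1) : G × H) • u) =
          (bisetPair (G := G.grp) (H := H.grp) u).conj ((g : G.grp.amb), 1) := by
        rw [bisetPair, FibSet.stabPair_smulA_eq, FibSet.stabPair_smul_eq]
        exact MPair.toAmb_conj (G := G.grp) (H := H.grp) _ g 1
      unfold actPair
      simp only [e4]
      exact conj_delta_star _ _ (ambStab_act (G := G.grp) (H := H.grp) hq).ge _

theorem map_actMor_heq (F : 𝓢.Obj R ⥤ ModuleCat.{w} R) {G H : CGroup.{u}}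
    {P P' : Subgroup G.amb} {Q Q' : Subgroup H.amb} (hP : P' = P) (hQ : Q' = Q)
    (mP : G.sub P ∈ 𝓢.𝒢) (mP' : G.sub P' ∈ 𝓢.𝒢) (mQ : H.sub Q ∈ 𝓢.𝒢) (mQ' : H.sub Q' ∈ 𝓢.𝒢)
    {p p' : MPair A (G.amb × H.amb)} (hp : p ∈ 𝓢.S (G.sub P) (H.sub Q))
    (hp' : p' ∈ 𝓢.S (G.sub P') (H.sub Q')) (h : p' = p)
    {y : F.obj ⟨H.sub Q, mQ⟩} {y' : F.obj ⟨H.sub Q', mQ'⟩} (hy : HEq y' y) :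
    HEq ((F.map (mor (G := ⟨G.sub P', mP'⟩) (H := ⟨H.sub Q', mQ'⟩) p' hp')).hom y')
      ((F.map (mor (G := ⟨G.sub P, mP⟩) (H := ⟨H.sub Q, mQ⟩) p hp)).hom y) := by
  subst hP hQ h
  obtain rfl := eq_of_heq hy
  rfl

/-- `Γ_F(U)` on morphisms: `α ↦ U ⊗_{AH} α`. -/
noncomputable def gammaMap {U : FibSet A (G × H)}
    (hU : ∀ u : U, bisetPair (G := G.grp) (H := H.grp) u ∈ 𝓢.SPlus G.grp H.grp)
    {X Y : Gamma F H} (α : X ⟶ Y) : gammaObj (G := G) hU X ⟶ gammaObj hU Y where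
  map := FibSet.Hom.actTens U α.map α.stab_eq
  stab_eq q := by
    obtain ⟨u, x, hq⟩ := FibSet.exists_amk q
    have hq' := FibSet.Hom.actTens_mk U α.map α.stab_eq hq
    ext g
    refine (FibSet.mem_stab_act hq' g).trans (Iff.trans ?_ (FibSet.mem_stab_act hq g).symm)
    rw [α.stab_eq]
  s_eq q := by
    obtain ⟨u, x, hq⟩ := FibSet.exists_amk q
    have hq' := FibSet.Hom.actTens_mk U α.map α.stab_eq hq
    have e1 : ambStab (G := H.grp) (α.map x) = ambStab (G := H.grp) x := by
      unfold ambStab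
      rw [α.stab_eq]
    have e2 : ambStab (G := G.grp) (FibSet.Hom.actTens U α.map α.stab_eq q) =
        ambStab (G := G.grp) (X := U.actTens X.X) q :=
      (ambStab_act (G := G.grp) (H := H.grp) hq').trans
        ((congrArg _ e1).trans (ambStab_act (G := G.grp) (H := H.grp) hq).symm)
    change HEq (actSec hU Y (FibSet.Hom.actTens U α.map α.stab_eq q)) (actSec hU X q)
    rw [actSec_eq hU X q hq, actSec_eq hU Y _ hq']
    refine map_actMor_heq F e2 e1 _ _ _ _ _ _ ?_ (α.s_eq x)
    unfold actPair
    simp only [e1]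

/-- The functor `Γ_F(U) : Γ_F(H) ⥤ Γ_F(G)`, `(X, s) ↦ (U ⊗_{AH} X, U(s))`, `α ↦ U ⊗_{AH} α`, for an
`A`-fibered `(G, H)`-biset `U` all of whose stabilizing pairs lie in `𝒮₊(G, H)`. -/
noncomputable def gammaFunctor (F : 𝓢.Obj R ⥤ ModuleCat.{w} R) {G H : 𝓢.Obj R}
    (U : FibSet A (G × H))
    (hU : ∀ u : U, bisetPair (G := G.grp) (H := H.grp) u ∈ 𝓢.SPlus G.grp H.grp) :
    Gamma F H ⥤ Gamma F G where
  obj X := gammaObj hU X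
  map α := gammaMap hU α
  map_id X := by
    refine Gamma.Hom.ext (FibSet.Hom.ext (funext fun q => ?_))
    obtain ⟨u, x, hq⟩ := FibSet.exists_amk q
    exact Subtype.ext ((FibSet.Hom.actTens_mk U (𝟙 X : X ⟶ X).map (𝟙 X : X ⟶ X).stab_eq
      hq).symm.trans hq)
  map_comp {X Y Z} α β := by
    refine Gamma.Hom.ext (FibSet.Hom.ext (funext fun q => ?_))
    obtain ⟨u, x, hq⟩ := FibSet.exists_amk q
    have h1 := FibSet.Hom.actTens_mk U α.map α.stab_eq hq
    have h2 := FibSet.Hom.actTens_mk U β.map β.stab_eq h1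
    exact Subtype.ext ((FibSet.Hom.actTens_mk U (α ≫ β).map (α ≫ β).stab_eq hq).symm.trans h2)

end GroupSystem

end Gamma

end Fibered

/-! The isomorphism is the associativity map (u ⊗ v) ⊗ x ↦ u ⊗ (v ⊗ x). Both bracketings come from
the orbits of H × K and two copies of A on U × V × X, and an orbit of triples that is A-free has
A-free inner tensors in either bracketing, so the same triples survive on both sides
(`FibSet.exists_actTens_assoc`). A bijective equivariant map preserves the stabilizers of A-orbits,
so what remains is to compare the sections.

By `actSec_eq` a section may be computed at any representative. At u ⊗ (v ⊗ x) the section of Γ_F(U)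
∘ Γ_F(V) is s(x) pushed through F of the class of ((H × K)_v, φ_v) ∗ (Δ(K_x), 1) and then through F
of the class of ((G × H)_u, φ_u) ∗ (Δ(H_{v ⊗ x}), 1). Functoriality turns this into F of a composite
in 𝒟. Since H_{v ⊗ x} = (H × K)_v ∗ K_x is the whole first projection of the pair belonging to v,
the Mackey formula has a single double coset, and the composite is the class of the product of the
two pairs. For the same reason the restriction to H_{v ⊗ x} is redundant in that product, and
associativity of ∗ leaves the product of the pairs of u and v, restricted to K_x (`actPair_star`).
The pair of u ⊗ v is the product of those of u and v, so this is the morphism that defines the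
section of Γ_F(U ⊗ V) at (u ⊗ v) ⊗ x (`actSec_assoc`).

That Γ_F(U ⊗ V) is defined amounts to closure of 𝒮₊ under products of composable pairs
(`SPlus.star`). With Q = p₁(E), the pairs (D, φ) ∈ 𝒮(p₁(D), H) and (E, ψ) ∈ 𝒮(Q, K) do not share a
middle group; the fourth axiom first cuts (D, φ) down to 𝒮(D ∗ Q, Q), which changes nothing in the
product, and then the third axiom applies. -/

namespace Fibered

/-! ### Associativity of the tensor product of two bisets and a fibered set -/

section Assoc

variable {A G H K : Type u} [CommGroup A] [Group G] [Group H] [Group K]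

/-- A bijective morphism between two fibered sets that are parametrized by the same `T`. -/
theorem FibSet.exists_hom_of_param {X Y : FibSet A G} {T : Type*} (p : T → X) (q : T → Y)
    (hp : Function.Surjective p) (hq : Function.Surjective q)
    (hpq : ∀ t t', p t = p t' ↔ q t = q t')
    (hG : ∀ (g : G) t, ∃ t', p t' = g • p t ∧ q t' = g • q t)
    (hA : ∀ (a : A) t, ∃ t', p t' = a • p t ∧ q t' = a • q t) :
    ∃ f : FibSet.Hom X Y, Function.Bijective f ∧ ∀ t, f (p t) = q t := by
  -- The morphism is q ∘ r for a section r of p; `hpq` makes it independent of the choice of r,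
  -- which gives both equivariance and the formula on p(t).
  choose r hr using hp
  have key : ∀ t, q (r (p t)) = q t := fun t => (hpq _ _).1 (hr _)
  refine ⟨⟨fun x => q (r x), fun g x => ?_, fun a x => ?_⟩, ⟨fun x y hxy => ?_, fun y => ?_⟩, key⟩
  · obtain ⟨t', h1, h2⟩ := hG g (r x)
    rw [hr] at h1
    rw [← h1, key, h2]
  · obtain ⟨t', h1, h2⟩ := hA a (r x)
    rw [hr] at h1
    rw [← h1, key, h2]
  · have := (hpq _ _).2 hxy
    rwa [hr, hr] at this
  · obtain ⟨t, rfl⟩ := hq y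
    exact ⟨p t, key t⟩

/-- The element `u ⊗ x`, for a pair whose orbit is `A`-free. -/
def FibSet.atmk {U : FibSet A (G × H)} {X : FibSet A H} (u : U) (x : X)
    (h : (U.amk X u x).Free) : U.actTens X := ⟨U.amk X u x, h⟩

theorem FibSet.atmk_surj {U : FibSet A (G × H)} {X : FibSet A H} (q : U.actTens X) :
    ∃ u x h, FibSet.atmk u x h = q := by
  obtain ⟨⟨u, x⟩, h⟩ := q
  exact ⟨u, x, h, rfl⟩

/-- The associativity isomorphism `(U ⊗ V) ⊗ X → U ⊗ (V ⊗ X)`, `(u ⊗ v) ⊗ x ↦ u ⊗ (v ⊗ x)`. -/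
theorem FibSet.exists_actTens_assoc (U : FibSet A (G × H)) (V : FibSet A (H × K))
    (X : FibSet A K) :
    ∃ f : FibSet.Hom ((U.bisetTens V).actTens X) (U.actTens (V.actTens X)),
      Function.Bijective f ∧
      (∀ q, ∃ u v x h₁ h₂, ∃ (h₃ : (V.amk X v x).Free)
        (_ : (U.amk (V.actTens X) u (FibSet.atmk v x h₃)).Free),
        q = FibSet.atmk (FibSet.btmk u v h₁) x h₂) ∧
      ∀ u v x h₁ h₂ h₃ h₄, f (FibSet.atmk (FibSet.btmk u v h₁) x h₂) =
        FibSet.atmk u (FibSet.atmk v x h₃) h₄ := by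
  -- R is the orbit relation on triples: h and the scalar b cross the first tensor sign, acting by
  -- b⁻¹ on U and by b on V, while k and c cross the second one. `h1` and `h2` show that equality of
  -- tensors is R in both bracketings.
  let R : U → V → X → U → V → X → Prop := fun u v w u' v' w' =>
    ∃ (h : H) (k : K) (b c : A), u' = b⁻¹ • ((1, h) : G × H) • u ∧
      v' = c⁻¹ • b • ((h, k) : H × K) • v ∧ w' = c • k • w
  have h1 : ∀ u v w u' v' w' h h', (U.bisetTens V).amk X (FibSet.btmk u v h) w =
      (U.bisetTens V).amk X (FibSet.btmk u' v' h') w' ↔ R u v w u' v' w' := by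
    intro u v w u' v' w' hh hh'
    rw [FibSet.amk_eq]
    constructor
    · rintro ⟨k, c, e1, e2⟩
      -- The scalar c⁻¹ acts on u ⊗ v through U by definition; it is moved to V, where R places it.
      obtain ⟨h, b, e3, e4⟩ := FibSet.bmk_eq.1 ((congrArg Subtype.val e1).trans
        (PreTens.smulA_mk' (c⁻¹) _ _)).symm
      have e3 : u' = b⁻¹ • ((1, h) : G × H) • (1 : G × H) • u := by
        rw [Prod.one_eq_mk]; exact e3
      have e4 : v' = b • ((h, 1) : H × K) • c⁻¹ • ((1, k) : H × K) • v := e4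
      refine ⟨h, k, b, c, by rwa [one_smul] at e3, ?_, e2⟩
      have : ((h, k) : H × K) = ((h, 1) : H × K) * ((1, k) : H × K) := by simp
      rw [e4, this, mul_smul, smul_comm _ c⁻¹, smul_comm b]
    · rintro ⟨h, k, b, c, e1, e2, e3⟩
      refine ⟨k, c, ?_, e3⟩
      refine Subtype.ext (Eq.trans ?_ (PreTens.smulA_mk' (c⁻¹) _ _).symm)
      -- The action of (1, k) on u ⊗ v applies (1, 1) to u and (1, k) to v, which explains the
      -- representatives given here.
      refine (FibSet.bmk_eq (u' := u') (v' := v')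
        (u := ((1, 1) : G × H) • u) (v := c⁻¹ • ((1, k) : H × K) • v)).2
        ⟨h, b, ?_, ?_⟩ |>.symm
      · rw [e1, ← Prod.one_eq_mk, one_smul]
      · have : ((h, k) : H × K) = ((h, 1) : H × K) * ((1, k) : H × K) := by simp
        rw [e2, this, mul_smul, smul_comm c⁻¹ b, smul_comm c⁻¹]
  have h2 : ∀ u v w u' v' w' h h', U.amk (V.actTens X) u (FibSet.atmk v w h) =
      U.amk (V.actTens X) u' (FibSet.atmk v' w' h') ↔ R u v w u' v' w' := by
    intro u v w u' v' w' hh hh'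
    -- On v ⊗ w both H and A act through the left factor, so w is untouched and only v has to be
    -- transformed.
    have e0 : ∀ (h : H) (b : A), (b • h • FibSet.atmk v w hh).1 =
        V.amk X (b • ((h, 1) : H × K) • v) w := fun h b =>
      (congrArg (b • ·) (FibSet.amk_smul h v w)).trans (FibSet.amk_smulA b _ w)
    rw [FibSet.amk_eq]
    constructor
    · rintro ⟨h, b, e1, e2⟩
      obtain ⟨k, c, e3, e4⟩ := FibSet.amk_eq.1 ((congrArg Subtype.val e2).trans (e0 h b)).symm
      refine ⟨h, k, b, c, e1, ?_, e4⟩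
      have : ((h, k) : H × K) = ((1, k) : H × K) * ((h, 1) : H × K) := by simp
      rw [e3, this, mul_smul, smul_comm _ b]
    · rintro ⟨h, k, b, c, e1, e2, e3⟩
      refine ⟨h, b, e1, Subtype.ext (Eq.trans ?_ (e0 h b).symm)⟩
      refine (FibSet.amk_eq.2 ⟨k, c, ?_, e3⟩).symm
      have : ((h, k) : H × K) = ((1, k) : H × K) * ((h, 1) : H × K) := by simp
      rw [e2, this, mul_smul, smul_comm b]
  -- F is A-freeness of the orbit of a triple. Phrased through R it favours no bracketing; `f1` and
  -- `f2` identify it with freeness of the iterated tensor, that of the inner tensor included.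
  let F : U → V → X → Prop := fun u v w => ∀ a : A, R (a • u) v w u v w → a = 1
  have f1 : ∀ u v w, F u v w ↔ ∃ h, ((U.bisetTens V).amk X (FibSet.btmk u v h) w).Free := by
    intro u v w
    constructor
    · intro hF
      have h : (U.bmk V u v).Free := by
        refine PreTens.free_iff.2 fun a ha => hF a ?_
        rw [FibSet.bmk_smulA, FibSet.bmk_eq] at ha
        obtain ⟨h, b, e1, e2⟩ := ha
        -- A scalar that fixes u ⊗ v also fixes the orbit of the triple: leave the second tensor
        -- sign alone, k = 1 and c = 1.
        exact ⟨h, 1, b, 1, e1, by simpa using e2, by simp⟩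
      exact ⟨h, PreTens.free_iff.2 fun a ha => hF a ((h1 _ _ _ _ _ _ (h.smulA a) h).1 ha)⟩
    · rintro ⟨h, hF⟩ a ha
      exact PreTens.free_iff.1 hF a ((h1 _ _ _ _ _ _ (h.smulA a) h).2 ha)
  have f2 : ∀ u v w, F u v w ↔ ∃ h, (U.amk (V.actTens X) u (FibSet.atmk v w h)).Free := by
    intro u v w
    constructor
    · intro hF
      have h : (V.amk X v w).Free := by
        refine PreTens.free_iff.2 fun a ha => hF a ?_
        rw [FibSet.amk_smulA, FibSet.amk_eq] at ha
        obtain ⟨k, c, e1, e2⟩ := ha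
        -- Here a fixes v ⊗ w, whereas F puts the scalar on u. Taking h = 1 and b = a carries it
        -- across the first tensor sign from u to v.
        refine ⟨1, k, a, c, by simp [← Prod.one_eq_mk], ?_, e2⟩
        rwa [smul_comm _ a] at e1
      exact ⟨h, PreTens.free_iff.2 fun a ha => hF a ((h2 _ _ _ _ _ _ h h).1 ha)⟩
    · rintro ⟨h, hF⟩ a ha
      exact PreTens.free_iff.1 hF a ((h2 _ _ _ _ _ _ h h).2 ha)
  -- Both sides are parametrized by the free triples, so the associativity map is the identity on
  -- parameters.
  let p : {p : U × V × X // F p.1 p.2.1 p.2.2} → (U.bisetTens V).actTens X := fun p =>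
    FibSet.atmk (FibSet.btmk p.1.1 p.1.2.1 ((f1 _ _ _).1 p.2).1) p.1.2.2 ((f1 _ _ _).1 p.2).2
  let q : {p : U × V × X // F p.1 p.2.1 p.2.2} → U.actTens (V.actTens X) := fun p =>
    FibSet.atmk p.1.1 (FibSet.atmk p.1.2.1 p.1.2.2 ((f2 _ _ _).1 p.2).1) ((f2 _ _ _).1 p.2).2
  have hp : Function.Surjective p := by
    intro z
    obtain ⟨z, w, hw, rfl⟩ := FibSet.atmk_surj z
    obtain ⟨u, v, hv, rfl⟩ := FibSet.btmk_surj z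
    exact ⟨⟨(u, v, w), (f1 _ _ _).2 ⟨hv, hw⟩⟩, rfl⟩
  suffices h : ∃ f : FibSet.Hom ((U.bisetTens V).actTens X) (U.actTens (V.actTens X)),
      Function.Bijective f ∧ ∀ t, f (p t) = q t by
    obtain ⟨f, hf, hfp⟩ := h
    refine ⟨f, hf, fun z => ?_, fun u v x h₁ h₂ h₃ h₄ => ?_⟩
    · obtain ⟨t, rfl⟩ := hp z
      exact ⟨t.1.1, t.1.2.1, t.1.2.2, _, _, _, ((f2 _ _ _).1 t.2).2, rfl⟩
    · exact hfp ⟨(u, v, x), (f1 _ _ _).2 ⟨h₁, h₂⟩⟩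
  refine FibSet.exists_hom_of_param p q hp ?_ ?_ ?_ ?_
  · intro z
    obtain ⟨u, z, hw, rfl⟩ := FibSet.atmk_surj z
    obtain ⟨v, w, hv, rfl⟩ := FibSet.atmk_surj z
    exact ⟨⟨(u, v, w), (f2 _ _ _).2 ⟨hv, hw⟩⟩, rfl⟩
  · rintro ⟨⟨u, v, w⟩, hp⟩ ⟨⟨u', v', w'⟩, hp'⟩
    exact ⟨fun h => Subtype.ext ((h2 _ _ _ _ _ _ _ _).2 ((h1 _ _ _ _ _ _ _ _).1
        (congrArg Subtype.val h))), fun h => Subtype.ext ((h1 _ _ _ _ _ _ _ _).2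
        ((h2 _ _ _ _ _ _ _ _).1 (congrArg Subtype.val h)))⟩
  · rintro g ⟨⟨u, v, w⟩, hp⟩
    obtain ⟨hq, hq'⟩ := (f1 _ _ _).1 hp
    have e := hq'.smul g
    -- G acts on a triple through u alone: the action of (g, 1) on u ⊗ v moves v only by the
    -- identity. Hence the transformed triple is (gu, v, w) in both bracketings.
    have E1 : ((g, 1) : G × K) • U.bmk V u v = U.bmk V (((g, 1) : G × H) • u) v :=
      congrArg (fun t => U.bmk V _ t) (one_smul (H × K) v)
    have e1 : ((g, 1) : G × K) • FibSet.btmk u v hq = FibSet.btmk (((g, 1) : G × H) • u) v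
        (E1 ▸ hq.smul ((g, 1) : G × K)) := Subtype.ext E1
    rw [FibSet.amk_smul, e1] at e
    refine ⟨⟨(((g, 1) : G × H) • u, v, w), (f1 _ _ _).2 ⟨_, e⟩⟩, ?_, ?_⟩
    · refine Subtype.ext (Eq.trans ?_ (FibSet.amk_smul _ _ _).symm)
      rw [e1]
      rfl
    · exact Subtype.ext (FibSet.amk_smul _ _ _).symm
  · rintro a ⟨⟨u, v, w⟩, hp⟩
    obtain ⟨hq, hq'⟩ := (f1 _ _ _).1 hp
    exact ⟨⟨(a • u, v, w), (f1 _ _ _).2 ⟨hq.smulA a, hq'.smulA a⟩⟩, rfl, rfl⟩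

/-- The stabilizers of `A`-orbits are preserved by injective morphisms. -/
theorem FibSet.Hom.stab_eq_of_injective {X Y : FibSet A G} (f : FibSet.Hom X Y)
    (hf : Function.Injective f) (x : X) : FibSet.stab (f x) = FibSet.stab x := by
  ext g
  refine exists_congr fun a => ?_
  rw [← f.map_smul, ← f.map_smulA, hf.eq_iff]

end Assoc

/-! ### Products of pairs and restriction by diagonal pairs -/

section Pairs

variable {A Γ Λ Θ : Type u} [CommGroup A] [Group Γ] [Group Λ] [Group Θ]

/-- Multiplying by (Δ(P), 1) only discards the elements of D whose second coordinate is outside P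
and keeps the values of φ on the others, so there are fewer conditions to satisfy and each was
already known. -/
theorem MPair.Compat.star_delta_left {p : MPair A (Γ × Λ)} {q : MPair A (Λ × Θ)}
    (hc : p.Compat q) (P : Subgroup Λ) :
    (p.star (MPair.delta A P) (MPair.compat_delta _ _)).Compat q := by
  intro h h0 h3
  obtain ⟨l, h1, h2⟩ := id h0
  obtain ⟨hl, rfl⟩ := MPair.mem_delta.1 h2
  rw [MPair.star_φ h1 h2, ← hc _ h1 h3]
  exact congrArg _ (mul_one _)

/-- As on the left: an element (h, 1) of the restricted subgroup already lies in E, with the same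
value of ψ. -/
theorem MPair.Compat.star_delta_right {p : MPair A (Γ × Λ)} {q : MPair A (Λ × Θ)}
    (hc : p.Compat q) (Q : Subgroup Θ) :
    p.Compat (q.star (MPair.delta A Q) (MPair.compat_delta _ _)) := by
  intro h h3 h0
  obtain ⟨l, h1, h2⟩ := id h0
  obtain ⟨hl, rfl⟩ := MPair.mem_delta.1 h2
  rw [MPair.star_φ h1 h2, hc _ h3 h1]
  exact (mul_one _).symm

/-- `((D, φ) ∗ (Δ(P), 1)) ∗ (E, ψ) = (D, φ) ∗ (E, ψ)` if `p₁(E) ≤ P`. -/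
theorem MPair.star_delta_star {p : MPair A (Γ × Λ)} {q : MPair A (Λ × Θ)} (hc : p.Compat q)
    {P : Subgroup Λ} (hP : ∀ x y, (x, y) ∈ q.D → x ∈ P) :
    (p.star (MPair.delta A P) (MPair.compat_delta _ _)).star q (hc.star_delta_left P) =
      p.star q hc := by
  refine MPair.ext' (fun x => ⟨?_, ?_⟩) (fun x hx hx' => ?_)
  · rintro ⟨l, ⟨l', h1, h2⟩, h3⟩
    obtain ⟨-, rfl⟩ := MPair.mem_delta.1 h2
    exact ⟨_, h1, h3⟩
  · rintro ⟨l, h1, h3⟩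
    -- The intermediate element l is a first coordinate in E, hence lies in P, so the detour through
    -- (l, l) ∈ Δ(P) is always available.
    exact ⟨l, ⟨l, h1, MPair.mem_delta.2 ⟨hP _ _ h3, rfl⟩⟩, h3⟩
  · obtain ⟨l, h1, h3⟩ := id hx'
    have h2 : (l, l) ∈ (MPair.delta A P).D := MPair.mem_delta.2 ⟨hP _ _ h3, rfl⟩
    refine (MPair.star_φ (hc := hc.star_delta_left P) (MPair.mem_star.2 ⟨l, h1, h2⟩) h3 hx).trans
      (Eq.trans ?_ (MPair.star_φ h1 h3 hx').symm)
    rw [MPair.star_φ h1 h2]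
    exact congrArg (· * _) (mul_one _)

/-- `(D, φ) ∗ ((E, ψ) ∗ (Δ(Q), 1)) = ((D, φ) ∗ (E, ψ)) ∗ (Δ(Q), 1)`. -/
theorem MPair.star_star_delta {p : MPair A (Γ × Λ)} {q : MPair A (Λ × Θ)} (hc : p.Compat q)
    (Q : Subgroup Θ) :
    p.star (q.star (MPair.delta A Q) (MPair.compat_delta _ _)) (hc.star_delta_right Q) =
      (p.star q hc).star (MPair.delta A Q) (MPair.compat_delta _ _) := by
  refine MPair.ext' (fun x => ⟨?_, ?_⟩) (fun x hx hx' => ?_)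
  · rintro ⟨l, h1, l', h2, h3⟩
    exact ⟨l', ⟨l, h1, h2⟩, h3⟩
  · rintro ⟨l', ⟨l, h1, h2⟩, h3⟩
    exact ⟨l, h1, l', h2, h3⟩
  · obtain ⟨l, h1, l', h2, h3⟩ := id hx
    refine (MPair.star_φ (hc := hc.star_delta_right Q) h1 (MPair.mem_star.2 ⟨l', h2, h3⟩) hx).trans
      (Eq.trans ?_ (MPair.star_φ (MPair.mem_star.2 ⟨l, h1, h2⟩) h3 hx').symm)
    -- The same intermediate elements l and l' serve on both sides, so the two values differ only in
    -- how a triple product in A is bracketed.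
    rw [MPair.star_φ h2 h3, MPair.star_φ h1 h2, mul_assoc]

/-- This matches the group p₁(D ∗ E) demanded by the definition of 𝒮₊ with the group D ∗ L that the
fourth axiom yields for L = p₁(E). -/
theorem proj₁_star {p : MPair A (Γ × Λ)} {q : MPair A (Λ × Θ)} (hc : p.Compat q) :
    proj₁ (p.star q hc).D = starSet p.D (proj₁ q.D) := by
  ext g
  constructor
  · rintro ⟨⟨g, k⟩, ⟨h, h1, h2⟩, rfl⟩
    exact ⟨h, ⟨(h, k), h2, rfl⟩, h1⟩
  · rintro ⟨_, ⟨⟨h, k⟩, h2, rfl⟩, h1⟩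
    exact ⟨(g, k), ⟨h, h1, h2⟩, rfl⟩

end Pairs

/-! ### Closure of 𝒮₊ under products, and the stabilizing pairs of u ⊗ v -/

namespace GroupSystem

variable {A : Type u} [CommGroup A] {𝓢 : GroupSystem A} {R : Type v} [CommRing R]

/-- `𝒮₊` is closed under products of composable pairs. -/
theorem SPlus.star {G H K : CGroup.{u}} (hH : H ∈ 𝓢.𝒢) (hK : K ∈ 𝓢.𝒢)
    {p : MPair A (G.amb × H.amb)} {q : MPair A (H.amb × K.amb)} (hp : p ∈ 𝓢.SPlus G H)
    (hq : q ∈ 𝓢.SPlus H K) (hc : p.Compat q) : p.star q hc ∈ 𝓢.SPlus G K := by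
  obtain ⟨lp, mp, sp⟩ := hp
  obtain ⟨lq, mq, sq⟩ := hq
  have hP : proj₁ q.D ≤ H.carrier := by
    rintro _ ⟨x, hx, rfl⟩
    exact (lq hx).1
  -- The fourth axiom is applied over p₁(D) and not over G, because (D, φ) is only known to lie in
  -- 𝒮(p₁(D), H). The resulting subgroup keeps the ambient group of G.
  have m := 𝓢.starSet_mem _ mp H hH p sp _ hP mq
  refine ⟨?_, ?_, ?_⟩
  · rintro ⟨g, k⟩ ⟨h, h1, h2⟩
    exact ⟨(lp h1).1, (lq h2).2⟩
  · rw [proj₁_star]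
    exact m
  -- Inserting the redundant factor (Δ(p₁(E)), 1) makes the middle groups agree: the fourth axiom
  -- puts the left part into 𝒮(D ∗ p₁(E), p₁(E)), and (E, ψ) lies in 𝒮(p₁(E), K), so the third axiom
  -- gives the product.
  · rw [proj₁_star, ← MPair.star_delta_star hc (P := proj₁ q.D)
      (fun x y h => ⟨(x, y), h, rfl⟩)]
    exact 𝓢.star_mem _ m _ mq _ hK _ (𝓢.star_delta_mem _ mp H hH p sp _ hP mq) _ sq _

/-- An h with (1, h) stabilizing the A-orbit of u and (h, 1) that of v multiplies u ⊗ v by φ_u(1, h)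
φ_v(h, 1) when it is carried across the tensor sign; A-freeness forces this scalar to be 1. -/
theorem bisetPair_compat {G H K : CGroup.{u}} {U : FibSet A (G × H)} {V : FibSet A (H × K)}
    {u : U} {v : V} (hf : (U.bmk V u v).Free) :
    (bisetPair (G := G) (H := H) u).Compat (bisetPair (G := H) (H := K) v) :=
  MPair.toAmb_compat.2 (FibSet.compat_of_free hf)

theorem bisetPair_btmk {G H K : CGroup.{u}} {U : FibSet A (G × H)} {V : FibSet A (H × K)}
    {u : U} {v : V} (hf : (U.bmk V u v).Free) :
    bisetPair (G := G) (H := K) (FibSet.btmk u v hf) =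
      (bisetPair (G := G) (H := H) u).star (bisetPair (G := H) (H := K) v)
        (bisetPair_compat hf) := by
  unfold bisetPair
  rw [FibSet.stabPair_btmk, MPair.toAmb_star]

/-! ### Comparison of the sections over the two bracketings -/

variable {F : 𝓢.Obj R ⥤ ModuleCat.{w} R} {G H K : 𝓢.Obj R}

/-- The first assertion of the proposition: every element of the tensor product is some u ⊗ v, and
its pair is the product of two composable members of 𝒮₊. -/
theorem bisetPair_tens_mem {U : FibSet A (G × H)} {V : FibSet A (H × K)}
    (hU : ∀ u : U, bisetPair (G := G.grp) (H := H.grp) u ∈ 𝓢.SPlus G.grp H.grp)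
    (hV : ∀ v : V, bisetPair (G := H.grp) (H := K.grp) v ∈ 𝓢.SPlus H.grp K.grp)
    (z : U.bisetTens V) : bisetPair (G := G.grp) (H := K.grp) z ∈ 𝓢.SPlus G.grp K.grp := by
  obtain ⟨u, v, hf, rfl⟩ := FibSet.btmk_surj z
  rw [bisetPair_btmk]
  exact SPlus.star H.mem K.mem (hU u) (hV v) _

/-- The pairs of u and v are composable already, and restricting them by diagonal pairs preserves
this; hence y may be any point here, not only v ⊗ x. -/
theorem actPair_compat {G H K : CGroup.{u}} {U : FibSet A (G × H)} {V : FibSet A (H × K)}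
    {X : FibSet A K} {u : U} {v : V} {x : X} (hf : (U.bmk V u v).Free) (y : V.actTens X) :
    (actPair (G := G) (H := H) u y).Compat (actPair (G := H) (H := K) v x) :=
  ((bisetPair_compat hf).star_delta_right _).star_delta_left _

/-- The product of the pairs of `u` at `v ⊗ x` and of `v` at `x` is the pair of `u ⊗ v` at `x`. -/
theorem actPair_star {G H K : CGroup.{u}} {U : FibSet A (G × H)} {V : FibSet A (H × K)}
    {X : FibSet A K} {u : U} {v : V} {x : X} (hf : (U.bmk V u v).Free) {y : V.actTens X}
    (hy : V.amk X v x = y.1) :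
    (actPair (G := G) (H := H) u y).star (actPair (G := H) (H := K) v x) (actPair_compat hf y) =
      actPair (G := G) (H := K) (FibSet.btmk u v hf) x := by
  unfold actPair
  simp only [bisetPair_btmk]
  -- The restriction to K_x is moved inside, next to the pair of v. The two sides then differ only
  -- by the factor (Δ(H_y), 1) in the middle.
  rw [← MPair.star_star_delta (bisetPair_compat hf)]
  -- That factor is redundant because a first coordinate h of the restricted pair of v comes with
  -- some l ∈ K_x and (h, l) ∈ (H × K)_v, which is exactly membership in H_{v ⊗ x}.
  refine MPair.star_delta_star _ fun h k hk => ?_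
  obtain ⟨l, h1, h2⟩ := hk
  obtain ⟨hl, rfl⟩ := MPair.mem_delta.1 h2
  rw [ambStab_act hy]
  exact ⟨l, hl, h1⟩

/-- Both values are F of a morphism of 𝒟 applied to s(x), and the two morphisms have the same pair.
The equality is heterogeneous since G_z and G_q are equal only through `hs`, so that the values live
in F(G_z) and F(G_q). The points z and q enter only through representatives, which lets z be the
image of q under the associativity map. -/
theorem actSec_assoc {U : FibSet A (G × H)} {V : FibSet A (H × K)}
    (hU : ∀ u : U, bisetPair (G := G.grp) (H := H.grp) u ∈ 𝓢.SPlus G.grp H.grp)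
    (hV : ∀ v : V, bisetPair (G := H.grp) (H := K.grp) v ∈ 𝓢.SPlus H.grp K.grp)
    (hUV : ∀ z : U.bisetTens V,
      bisetPair (G := G.grp) (H := K.grp) z ∈ 𝓢.SPlus G.grp K.grp)
    (X : Gamma F K) {u : U} {v : V} {x : X.X} {h₁ : (U.bmk V u v).Free}
    {q : (U.bisetTens V).actTens X.X} (hq : (U.bisetTens V).amk X.X (FibSet.btmk u v h₁) x = q.1)
    {y : V.actTens X.X} (hy : V.amk X.X v x = y.1)
    {z : U.actTens (V.actTens X.X)} (hz : U.amk (V.actTens X.X) u y = z.1)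
    (hs : FibSet.stab z = FibSet.stab q) :
    HEq (actSec hU (gammaObj hV X) z) (actSec hUV X q) := by
  -- Independence of the representative replaces the chosen ones by (u ⊗ v, x) for q and (u, y) for
  -- z, and then by (v, x) for y.
  rw [actSec_eq hUV X q hq, actSec_eq hU (gammaObj hV X) z (u := u) (x := y) hz]
  change HEq ((F.map (actMor hU (gammaObj hV X).mem u y z hz)).hom (actSec hV X y)) _
  rw [actSec_eq hV X y hy]
  have e (P Q S : 𝓢.Obj R) (b : S ⟶ Q) (a : Q ⟶ P) (t : F.obj S) :
      (F.map a).hom ((F.map b).hom t) = (F.map (b ≫ a)).hom t := by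
    rw [F.map_comp]
    rfl
  refine (heq_of_eq ((e _ _ _ _ _ _).trans (congrArg (fun m => (F.map m).hom (X.s x)) (mor_comp
    (G := stabObj (G := G) (stab_act_mem H.mem hU (gammaObj hV X).mem) z)
    (H := stabObj (G := H) (stab_act_mem K.mem hV X.mem) y) (K := stabObj X.mem x) _ _
    (actPair_compat (G := G.grp) (H := H.grp) (K := K.grp) h₁ y) ?_)))).trans ?_
  -- There is one double coset: every h in H_y = (H × K)_v ∗ K_x occurs as a first coordinate in the
  -- right-hand pair, so h = 1 · h is the required factorization.
  · intro h hh
    have hh : h ∈ ambStab (G := H.grp) y := hh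
    rw [ambStab_act (G := H.grp) (H := K.grp) hy] at hh
    obtain ⟨k, hk, hm⟩ := hh
    exact ⟨1, h, 1, k, (one_mul h).symm, one_mem _,
      MPair.mem_star.2 ⟨k, hm, MPair.mem_delta.2 ⟨hk, rfl⟩⟩⟩
  -- The source K_x is literally the same on both sides; the targets are identified by `hs` and the
  -- pairs by `actPair_star`.
  · refine map_actMor_heq F (congrArg (Subgroup.map _) hs) rfl _ _ _ _ _ _
      (actPair_star (G := G.grp) (H := H.grp) (K := K.grp) h₁ hy) HEq.rfl

/-- A morphism of `Γ_F(G)` whose underlying map is bijective is an isomorphism. -/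
theorem Gamma.isIso_of_bijective {X Y : Gamma F G} (f : X ⟶ Y)
    (hf : Function.Bijective (Gamma.Hom.map f)) : IsIso f := by
  let e := Equiv.ofBijective _ hf
  have he : ∀ y, (Gamma.Hom.map f) (e.symm y) = y := e.apply_symm_apply
  let i : FibSet.Hom Y.X X.X :=
    ⟨e.symm, fun g y => hf.1 (by rw [he, (Gamma.Hom.map f).map_smul, he]),
      fun a y => hf.1 (by rw [he, (Gamma.Hom.map f).map_smulA, he])⟩
  -- Both conditions on the inverse at y are those on f at the preimage of y, read backwards.
  let j : Y ⟶ X :=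
    { map := i
      stab_eq := fun y => by
        rw [← Gamma.Hom.stab_eq f]
        exact congrArg FibSet.stab (he y)
      s_eq := fun y => by
        refine (Gamma.Hom.s_eq f (e.symm y)).symm.trans ?_
        rw [he] }
  exact ⟨j, Gamma.Hom.ext (FibSet.Hom.ext (funext e.symm_apply_apply)),
    Gamma.Hom.ext (FibSet.Hom.ext (funext he))⟩

end GroupSystem

end Fibered

/-! ### The natural isomorphism -/

open Fibered Fibered.GroupSystem in
theorem mainTheorem10 {A : Type u} [CommGroup A] (𝓢 : Fibered.GroupSystem A)
    (R : Type v) [CommRing R] (F : 𝓢.Obj R ⥤ ModuleCat.{w} R) [F.Additive] [F.Linear R]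
    (G H K : 𝓢.Obj R) (U : Fibered.FibSet A (G × H)) (V : Fibered.FibSet A (H × K))
    (hU : ∀ u : U, Fibered.GroupSystem.bisetPair (G := G.grp) (H := H.grp) u ∈
      𝓢.SPlus G.grp H.grp)
    (hV : ∀ v : V, Fibered.GroupSystem.bisetPair (G := H.grp) (H := K.grp) v ∈
      𝓢.SPlus H.grp K.grp) :
    ∃ hUV : ∀ z : U.bisetTens V, Fibered.GroupSystem.bisetPair (G := G.grp) (H := K.grp) z ∈
        𝓢.SPlus G.grp K.grp,
      Nonempty (Fibered.GroupSystem.gammaFunctor F (U.bisetTens V) hUV ≅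
        Fibered.GroupSystem.gammaFunctor F V hV ⋙ Fibered.GroupSystem.gammaFunctor F U hU) := by
  refine ⟨bisetPair_tens_mem hU hV, ?_⟩
  -- The formula on pure tensors is kept along with the bijection, since the comparison of sections
  -- and naturality both depend on it.
  choose f hf hq hfq using fun X : Gamma F K => FibSet.exists_actTens_assoc U V X.X
  let φ (X : Gamma F K) : (gammaFunctor F (U.bisetTens V) (bisetPair_tens_mem hU hV)).obj X ⟶
      (gammaFunctor F V hV ⋙ gammaFunctor F U hU).obj X :=
    { map := f X
      stab_eq := (f X).stab_eq_of_injective (hf X).1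
      s_eq := fun q => by
        have hs := (f X).stab_eq_of_injective (hf X).1 q
        obtain ⟨u, v, x, h₁, h₂, h₃, h₄, rfl⟩ := hq X q
        -- Here y = v ⊗ x, and z is the image of q under the associativity map, which is u ⊗ y by
        -- the formula.
        exact actSec_assoc hU hV (bisetPair_tens_mem hU hV) X rfl
          (y := FibSet.atmk v x h₃) rfl (congrArg Subtype.val (hfq X u v x h₁ h₂ h₃ h₄)).symm hs }
  have (X : Gamma F K) : IsIso (φ X) := Gamma.isIso_of_bijective _ (hf X)
  refine ⟨NatIso.ofComponents (fun X => asIso (φ X)) fun {X Y} α => ?_⟩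
  refine Gamma.Hom.ext (FibSet.Hom.ext (funext fun q => ?_))
  -- Naturality is checked on pure tensors, where both ways round the square lead to u ⊗ (v ⊗ α(x)).
  obtain ⟨u, v, x, h₁, h₂, h₃, h₄, rfl⟩ := hq X q
  -- The formula for Y needs freeness of the tensors containing α(x). It is read off from the images
  -- under the induced maps, which stay among the free orbits because α preserves stabilizers.
  have a₁ := (FibSet.Hom.actTens (U.bisetTens V) α.map α.stab_eq
    (FibSet.atmk (FibSet.btmk u v h₁) x h₂)).2
  let y := FibSet.Hom.actTens V α.map α.stab_eq (FibSet.atmk v x h₃)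
  let z := ((gammaFunctor F V hV ⋙ gammaFunctor F U hU).map α).map
    (FibSet.atmk u (FibSet.atmk v x h₃) h₄)
  exact (hfq Y u v (α.map x) h₁ a₁ y.2 z.2).trans (congrArg
    ((gammaFunctor F V hV ⋙ gammaFunctor F U hU).map α).map (hfq X u v x h₁ h₂ h₃ h₄)).symm
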